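/- **Setting.** Let $(X_0,X_1)$ be an interpolation couple, i.e. two Banach spaces continuously embedded in the same Hausdorff topological vector space. Let $X_0\cap X_1$ and $X_0+X_1$ carry the norms $\max(\|a\|_{X_0},\|a\|_{X_1})$ and $\inf\{\|a_0\|_{X_0}+\|a_1\|_{X_1}: a=a_0+a_1,\ a_i\in X_i\}$. For $t>0$ put $$K(t,a)=\inf\{\|a_0\|_{X_0}+t\|a_1\|_{X_1}: a=a_0+a_1,\ a_i\in X_i\}\quad(a\in X_0+X_1),\qquad J(t,a)=\max(\|a\|_{X_0},t\|a\|_{X_1})\quad(a\in X_0\cap X_1).$$ For $p\in(1,\infty)$, a function $\phi:\mathbb R_+\to\mathbb R_+$ and a measurable $F:\mathbb R_+=(0,\infty)\to[0,\infty]$ put $\Phi^\phi_p(F)=\big(\int_0^\infty(\phi(t^{-1})F(t))^p\,\frac{dt}{t}\big)^{1/p}$, and let $$(X_0,X_1)_{\phi,p}=\{a\in X_0+X_1:\ \|a\|_{(X_0,X_1)_{\phi,p}}:=\Phi^\phi_p(K(\cdot,a))<\infty\}.$$ A weight $w:\mathbb R\to[0,\infty)$ (measurable, positive a.e.) belongs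 to $A_p$ if $$[w]_{A_p}=\sup_{a<b}\Big(\frac1{b-a}\int_a^b w\,dt\Big)\Big(\frac1{b-a}\int_a^b w^{-1/(p-1)}\,dt\Big)^{p-1}<\infty .$$ Write $W(t)=\int_0^t w(s)\,ds$, and $\|g\|_{L_p(\mathbb R_+,w\,dt;X)}=\big(\int_0^\infty\|g(t)\|_X^p\,w(t)\,dt\big)^{1/p}$. **Theorem (extension theorem with local derivative).** Let $p\in(1,\infty)$. For each value of $[w]_{A_p}$ there is a constant $N=N(p,[w]_{A_p})$ such that for every interpolation couple $(X_0,X_1)$, every $w\in A_p$ and every $a\in(X_0,X_1)_{W^{1/p},p}$ there exist $u:[0,\infty)\to X_0+X_1$ with $u|_{\mathbb R_+}\in L_p(\mathbb R_+,w\,dt;X_0)$ and $f\in L_p(\mathbb R_+,w\,dt;X_1)$, with $f$ integrable on $(0,t)$ for every $t>0$, such that $u(0)=a$ and $$u(t)=a+\int_0^t f(s)\,ds\qquad\text{for all }t>0,$$ and $$\|u\|_{L_p(\mathbb R_+,w\,dt;X_0)}+\|f\|_{L_p(\mathbb R_+,w\,dt;X_1)}\le N\,\|a\|_{(X_0,X_1)_{W^{1/p},p}}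 .$$ Moreover, $u$ can be chosen of the form $$u(t)=\int_0^\infty e^{-t\lambda}v(\lambda)\,\frac{d\lambda}{\lambda}\qquad(t\ge0),$$ where $v:\mathbb R_+\to X_0\cap X_1$ is strongly measurable, $a=\int_0^\infty v(\lambda)\,\frac{d\lambda}{\lambda}$ and $\Phi^{W^{1/p}}_p\big(J(\cdot,v(\cdot))\big)\le N\,\|a\|_{(X_0,X_1)_{W^{1/p},p}}$; these integrals are Bochner integrals in $X_0+X_1$. -/

import Mathlib

open MeasureTheory Set
open scoped ENNReal NNReal

noncomputable section

/-- An interpolation couple: two (Banach) spaces continuously embedded in the same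
(Hausdorff) topological vector space `Z`. -/
structure InterpolationCouple (X₀ X₁ Z : Type*)
    [NormedAddCommGroup X₀] [NormedSpace ℝ X₀] [NormedAddCommGroup X₁] [NormedSpace ℝ X₁]
    [AddCommGroup Z] [Module ℝ Z] [TopologicalSpace Z] where
  /-- the embedding of `X₀` in `Z` -/
  emb₀ : X₀ →L[ℝ] Z
  /-- the embedding of `X₁` in `Z` -/
  emb₁ : X₁ →L[ℝ] Z
  emb₀_injective : Function.Injective emb₀
  emb₁_injective : Function.Injective emb₁

namespace InterpolationCouple

variable {X₀ X₁ Z : Type*}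
  [NormedAddCommGroup X₀] [NormedSpace ℝ X₀] [NormedAddCommGroup X₁] [NormedSpace ℝ X₁]
  [AddCommGroup Z] [Module ℝ Z] [TopologicalSpace Z] [IsTopologicalAddGroup Z]

/-- The map `(x₀, x₁) ↦ x₀ + x₁` into `Z`, on the product with norm `‖x₀‖ + ‖x₁‖`. -/
def addMap (C : InterpolationCouple X₀ X₁ Z) : WithLp 1 (X₀ × X₁) →L[ℝ] Z :=
  (C.emb₀.coprod C.emb₁).comp
    (WithLp.prodContinuousLinearEquiv 1 ℝ X₀ X₁ : WithLp 1 (X₀ × X₁) →L[ℝ] X₀ × X₁)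

/-- The kernel of `(x₀, x₁) ↦ x₀ + x₁`. -/
def addKer (C : InterpolationCouple X₀ X₁ Z) : Submodule ℝ (WithLp 1 (X₀ × X₁)) :=
  LinearMap.ker (C.addMap : WithLp 1 (X₀ × X₁) →ₗ[ℝ] Z)

instance isClosed_addKer [T2Space Z] (C : InterpolationCouple X₀ X₁ Z) :
    IsClosed (C.addKer : Set (WithLp 1 (X₀ × X₁))) :=
  C.addMap.isClosed_ker

/-- The space `X₀ + X₁ ⊆ Z`, realized as the quotient of `X₀ × X₁` by the kernel of addition into
`Z`; the quotient norm is the infimum of `‖a₀‖ + ‖a₁‖` over all decompositions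
`a = a₀ + a₁` (see `toZ_injective`, `range_toZ` and `norm_eq_sInf`). -/
abbrev SumSpace (C : InterpolationCouple X₀ X₁ Z) : Type _ := WithLp 1 (X₀ × X₁) ⧸ C.addKer

/-- The embedding `X₀ ⊆ X₀ + X₁`. -/
def inl (C : InterpolationCouple X₀ X₁ Z) : X₀ →ₗ[ℝ] C.SumSpace :=
  C.addKer.mkQ ∘ₗ (WithLp.linearEquiv 1 ℝ (X₀ × X₁)).symm.toLinearMap ∘ₗ LinearMap.inl ℝ X₀ X₁

/-- The embedding `X₁ ⊆ X₀ + X₁`. -/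
def inr (C : InterpolationCouple X₀ X₁ Z) : X₁ →ₗ[ℝ] C.SumSpace :=
  C.addKer.mkQ ∘ₗ (WithLp.linearEquiv 1 ℝ (X₀ × X₁)).symm.toLinearMap ∘ₗ LinearMap.inr ℝ X₀ X₁

/-- The inclusion of `X₀ + X₁` in `Z`. -/
def toZ (C : InterpolationCouple X₀ X₁ Z) : C.SumSpace →ₗ[ℝ] Z :=
  C.addKer.liftQ (C.addMap : WithLp 1 (X₀ × X₁) →ₗ[ℝ] Z) le_rfl

theorem toZ_injective (C : InterpolationCouple X₀ X₁ Z) : Function.Injective C.toZ :=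
  LinearMap.ker_eq_bot.mp (Submodule.ker_liftQ_eq_bot _ _ le_rfl le_rfl)

@[simp] theorem toZ_inl (C : InterpolationCouple X₀ X₁ Z) (x : X₀) :
    C.toZ (C.inl x) = C.emb₀ x := by
  simp [toZ, inl, addMap]

@[simp] theorem toZ_inr (C : InterpolationCouple X₀ X₁ Z) (x : X₁) :
    C.toZ (C.inr x) = C.emb₁ x := by
  simp [toZ, inr, addMap]

theorem mk_eq_inl_add_inr (C : InterpolationCouple X₀ X₁ Z) (x : WithLp 1 (X₀ × X₁)) :
    (Submodule.Quotient.mk x : C.SumSpace) = C.inl x.fst + C.inr x.snd := by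
  apply C.toZ_injective
  rw [map_add, toZ_inl, toZ_inr]
  simp [toZ, addMap]

/-- As a subset of `Z`, the space `X₀ + X₁` consists of the sums `x₀ + x₁`. -/
theorem range_toZ (C : InterpolationCouple X₀ X₁ Z) :
    Set.range C.toZ = {z | ∃ x₀ x₁, z = C.emb₀ x₀ + C.emb₁ x₁} := by
  ext z
  constructor
  · rintro ⟨a, rfl⟩
    obtain ⟨x, rfl⟩ := Submodule.Quotient.mk_surjective _ a
    exact ⟨x.fst, x.snd, by rw [mk_eq_inl_add_inr, map_add, toZ_inl, toZ_inr]⟩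
  · rintro ⟨x₀, x₁, rfl⟩
    exact ⟨C.inl x₀ + C.inr x₁, by rw [map_add, toZ_inl, toZ_inr]⟩

/-- The norm of `X₀ + X₁`. -/
theorem norm_eq_sInf [T2Space Z] (C : InterpolationCouple X₀ X₁ Z) (a : C.SumSpace) :
    ‖a‖ = sInf {r | ∃ x₀ x₁, a = C.inl x₀ + C.inr x₁ ∧ r = ‖x₀‖ + ‖x₁‖} := by
  have hle (r : ℝ) : r ≤ ‖a‖ ↔ ∀ m, (Submodule.Quotient.mk m : C.SumSpace) = a → r ≤ ‖m‖ :=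
    QuotientAddGroup.le_norm_iff (S := C.addKer.toAddSubgroup) (x := a)
  refine (IsGLB.csInf_eq ⟨?_, ?_⟩ ?_).symm
  · rintro r ⟨x₀, x₁, h, rfl⟩
    have := (hle ‖a‖).1 le_rfl (WithLp.toLp 1 (x₀, x₁)) (by rw [mk_eq_inl_add_inr]; exact h.symm)
    simpa [WithLp.prod_norm_eq_of_L1] using this
  · intro r hr
    refine (hle r).2 fun m hm => hr ⟨m.fst, m.snd, ?_, ?_⟩
    · rw [← mk_eq_inl_add_inr]; exact hm.symm
    · simp [WithLp.prod_norm_eq_of_L1]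
  · obtain ⟨m, hm⟩ := Submodule.Quotient.mk_surjective _ a
    exact ⟨_, m.fst, m.snd, by rw [← mk_eq_inl_add_inr]; exact hm.symm, rfl⟩

/-- The space `X₀ ∩ X₁`, realized as the pairs `(x₀, x₁)` with the same image in `Z`;
its norm, inherited from the product, is `max ‖x₀‖ ‖x₁‖`. -/
def interSpace (C : InterpolationCouple X₀ X₁ Z) : Submodule ℝ (X₀ × X₁) :=
  LinearMap.ker (C.emb₀.coprod (-C.emb₁) : X₀ × X₁ →ₗ[ℝ] Z)

theorem mem_interSpace (C : InterpolationCouple X₀ X₁ Z) (x : X₀ × X₁) :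
    x ∈ C.interSpace ↔ C.emb₀ x.1 = C.emb₁ x.2 := by
  simp [interSpace, ← sub_eq_add_neg, sub_eq_zero]

/-- The embedding `X₀ ∩ X₁ ⊆ X₀ + X₁`. -/
def ofInter (C : InterpolationCouple X₀ X₁ Z) : C.interSpace →ₗ[ℝ] C.SumSpace :=
  C.inl ∘ₗ LinearMap.fst ℝ X₀ X₁ ∘ₗ C.interSpace.subtype

theorem ofInter_eq_inr (C : InterpolationCouple X₀ X₁ Z) (x : C.interSpace) :
    C.ofInter x = C.inr (x : X₀ × X₁).2 := by
  apply C.toZ_injective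
  rw [toZ_inr, ← (C.mem_interSpace _).1 x.2]
  simp [ofInter]

/-- The functional `K(t, a) = inf {‖a₀‖ + t ‖a₁‖ : a = a₀ + a₁}`. -/
def K (C : InterpolationCouple X₀ X₁ Z) (t : ℝ) (a : C.SumSpace) : ℝ≥0∞ :=
  ⨅ (x₀ : X₀) (x₁ : X₁) (_ : a = C.inl x₀ + C.inr x₁), ‖x₀‖ₑ + ENNReal.ofReal t * ‖x₁‖ₑ

/-- The functional `J(t, a) = max (‖a‖_{X₀}) (t ‖a‖_{X₁})` on `X₀ ∩ X₁`. -/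
def J (C : InterpolationCouple X₀ X₁ Z) (t : ℝ) (a : C.interSpace) : ℝ≥0∞ :=
  max ‖(a : X₀ × X₁).1‖ₑ (ENNReal.ofReal t * ‖(a : X₀ × X₁).2‖ₑ)

end InterpolationCouple

/-- `(∫₀^∞ (φ(t⁻¹) F(t))^p dt/t)^{1/p}`. -/
def interpFunctional (φ : ℝ → ℝ≥0∞) (p : ℝ) (F : ℝ → ℝ≥0∞) : ℝ≥0∞ :=
  (∫⁻ t in Ioi (0 : ℝ), (φ t⁻¹ * F t) ^ p * ENNReal.ofReal t⁻¹) ^ (1 / p)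

namespace InterpolationCouple

variable {X₀ X₁ Z : Type*}
  [NormedAddCommGroup X₀] [NormedSpace ℝ X₀] [NormedAddCommGroup X₁] [NormedSpace ℝ X₁]
  [AddCommGroup Z] [Module ℝ Z] [TopologicalSpace Z] [IsTopologicalAddGroup Z]

/-- The norm of `(X₀, X₁)_{φ,p}` given by the `K`-method, with value `∞` off the space. -/
def interpNorm (C : InterpolationCouple X₀ X₁ Z) (φ : ℝ → ℝ≥0∞) (p : ℝ) (a : C.SumSpace) : ℝ≥0∞ :=
  interpFunctional φ p (fun t => C.K t a)

/-- The interpolation space `(X₀, X₁)_{φ,p}` (as a subset of `X₀ + X₁`). -/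
def interpSpace (C : InterpolationCouple X₀ X₁ Z) (φ : ℝ → ℝ≥0∞) (p : ℝ) : Set C.SumSpace :=
  {a | C.interpNorm φ p a < ∞}

/-- `v : (0,∞) → X₀ ∩ X₁` is strongly measurable and `a = ∫₀^∞ v(t) dt/t` as a Bochner integral
in `X₀ + X₁`. -/
structure IsJRepresentation [T2Space Z] (C : InterpolationCouple X₀ X₁ Z)
    (v : ℝ → C.interSpace) (a : C.SumSpace) : Prop where
  aestronglyMeasurable : AEStronglyMeasurable v (volume.restrict (Ioi 0))
  integrableOn : IntegrableOn (fun t : ℝ => t⁻¹ • C.ofInter (v t)) (Ioi 0)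
  integral_eq : a = ∫ t in Ioi (0 : ℝ), t⁻¹ • C.ofInter (v t)

end InterpolationCouple

/-- The Muckenhoupt constant `[w]_{A_p}` of a weight on the real line. -/
def muckenhouptConst (p : ℝ) (w : ℝ → ℝ≥0) : ℝ≥0∞ :=
  ⨆ (a : ℝ) (b : ℝ) (_ : a < b),
    ((ENNReal.ofReal (b - a))⁻¹ * ∫⁻ t in Icc a b, (w t : ℝ≥0∞)) *
      ((ENNReal.ofReal (b - a))⁻¹ * ∫⁻ t in Icc a b, (w t : ℝ≥0∞) ^ (-(1 / (p - 1)))) ^ (p - 1)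

/-- The class `A_p` on the real line. As usual a weight is positive almost everywhere; given that
the constant is finite, this only excludes `w = 0` a.e., for which the convention `0 * ∞ = 0` would
give the constant `0`. -/
structure IsMuckenhoupt (p : ℝ) (w : ℝ → ℝ≥0) : Prop where
  aemeasurable : AEMeasurable w
  ae_pos : ∀ᵐ t, 0 < w t
  const_lt_top : muckenhouptConst p w < ∞

/-- `W(t) = ∫₀ᵗ w(s) ds` for `t > 0`. -/
def weightPrimitive (w : ℝ → ℝ≥0) (t : ℝ) : ℝ≥0∞ := ∫⁻ s in Ioc 0 t, (w s : ℝ≥0∞)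

/-- The measure `w dt` on `(0,∞)`. -/
def weightMeasure (w : ℝ → ℝ≥0) : Measure ℝ :=
  (volume.restrict (Ioi 0)).withDensity (fun t => (w t : ℝ≥0∞))

end

/-
Quasiconcavity of `K(·,a)` bounds the Laplace transform of `K(r,a)/r` at `t` by the dyadic sum
`2 ∑ₖ K(2⁻ᵏ t⁻¹, a)`. The `A_p` condition forces reverse doubling `W(s) ≤ θ W(2s)` with `θ < 1`, so
the norms of the summands in `L_p(w dt)` decay geometrically and the Laplace transform has norm at
most a multiple of `‖a‖`. Moreover `w^{-1/(p-1)}` is locally integrable, so by Hölder's inequality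
the Laplace transform is integrable near `0`; this is the integrability of `K(·,a)` which lets the
fundamental lemma of interpolation theory produce a representation `a = ∫ v(r) dr/r` with
`J(r,v(r)) ≤ 16 K(r,a)`. Now `u(t) = ∫ e^{-tr} v(r) dr/r` works, because
`‖v(r)/r‖_{X₀}` and `‖v(r)‖_{X₁}` are both at most `J(r,v(r))/r`.
-/

noncomputable section

open Filter Topology

theorem eLpNorm_tsum_le_tsum {α ι : Type*} [MeasurableSpace α] {μ : Measure α} [Countable ι]
    {p : ℝ≥0∞} (hp : 1 ≤ p) {F : ι → α → ℝ≥0∞} (hF : ∀ i, AEMeasurable (F i) μ) :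
    eLpNorm (fun x => ∑' i, F i x) p μ ≤ ∑' i, eLpNorm (F i) p μ := by
  rcases eq_or_ne p ∞ with rfl | hp_top
  · simp only [eLpNorm_exponent_top]
    refine essSup_le_of_ae_le _ ?_
    filter_upwards [ae_all_iff.2 fun i => ae_le_eLpNormEssSup (f := F i) (μ := μ)] with x hx
    exact ENNReal.tsum_le_tsum hx
  have hp_pos : 0 < p := zero_lt_one.trans_le hp
  have hq : 0 < p.toReal := ENNReal.toReal_pos hp_pos.ne' hp_top
  rw [← ENNReal.rpow_le_rpow_iff hq, eLpNorm_eq_lintegral_rpow_enorm_toReal hp_pos.ne' hp_top,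
    one_div, ENNReal.rpow_inv_rpow hq.ne']
  have hsup (x : α) : ‖∑' i, F i x‖ₑ ^ p.toReal =
      ⨆ s : Finset ι, (∑ i ∈ s, F i x) ^ p.toReal := by
    rw [enorm_eq_self, ENNReal.tsum_eq_iSup_sum]
    exact (ENNReal.orderIsoRpow _ hq).map_iSup _
  simp_rw [hsup]
  rw [lintegral_iSup_directed (fun s => by fun_prop)]
  · refine iSup_le fun s => ?_
    calc ∫⁻ x, (∑ i ∈ s, F i x) ^ p.toReal ∂μ = eLpNorm (∑ i ∈ s, F i) p μ ^ p.toReal := by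
          rw [eLpNorm_eq_lintegral_rpow_enorm_toReal hp_pos.ne' hp_top, one_div,
            ENNReal.rpow_inv_rpow hq.ne']
          simp
      _ ≤ (∑' i, eLpNorm (F i) p μ) ^ p.toReal := by
          gcongr
          exact (eLpNorm_sum_le (fun i _ => (hF i).aestronglyMeasurable) hp).trans
            (ENNReal.sum_le_tsum s)
  · exact Monotone.directed_le fun s t hst x => by dsimp only; gcongr

theorem setLIntegral_ofReal_inv_Ioc {a b : ℝ} (ha : 0 < a) (hab : a ≤ b) :
    ∫⁻ r in Ioc a b, ENNReal.ofReal r⁻¹ = ENNReal.ofReal (Real.log (b / a)) := by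
  have hint : IntegrableOn (fun r : ℝ => r⁻¹) (Ioc a b) :=
    ((continuousOn_inv₀.mono fun r hr => (ha.trans_le hr.1).ne').integrableOn_Icc).mono_set
      Ioc_subset_Icc_self
  rw [← integral_inv_of_pos ha (ha.trans_le hab), intervalIntegral.integral_of_le hab,
    ofReal_integral_eq_lintegral_ofReal hint]
  filter_upwards [ae_restrict_mem measurableSet_Ioc] with r hr
  exact inv_nonneg.2 (ha.trans hr.1).le

/-- The Laplace transform of a function on `(0,∞)` with values in `[0,∞]`. -/
def elaplace (G : ℝ → ℝ≥0∞) (t : ℝ) : ℝ≥0∞ :=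
  ∫⁻ r in Ioi (0 : ℝ), ENNReal.ofReal (Real.exp (-(t * r))) * G r

theorem elaplace_mono {F G : ℝ → ℝ≥0∞} (h : ∀ r, 0 < r → F r ≤ G r) (t : ℝ) :
    elaplace F t ≤ elaplace G t :=
  setLIntegral_mono' measurableSet_Ioi fun r hr => mul_le_mul_right (h r hr) _

theorem antitone_elaplace (G : ℝ → ℝ≥0∞) : Antitone (elaplace G) := by
  refine fun s t hst => setLIntegral_mono' measurableSet_Ioi fun r hr => ?_
  gcongr
  exact le_of_lt hr

theorem elaplace_ne_top {G : ℝ → ℝ≥0∞} {t : ℝ} (ht : 0 < t)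
    (h : ∫⁻ s in Ioc 0 t, elaplace G s ≠ ∞) : elaplace G t ≠ ∞ := by
  have hle : elaplace G t * ENNReal.ofReal t ≤ ∫⁻ s in Ioc 0 t, elaplace G s :=
    calc elaplace G t * ENNReal.ofReal t = ∫⁻ _ in Ioc 0 t, elaplace G t := by
          rw [setLIntegral_const, Real.volume_Ioc, sub_zero]
      _ ≤ ∫⁻ s in Ioc 0 t, elaplace G s :=
          setLIntegral_mono' measurableSet_Ioc fun s hs => antitone_elaplace G hs.2
  exact (ENNReal.lt_top_of_mul_ne_top_left (ne_top_of_le_ne_top h hle) (by simpa using ht)).ne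

theorem lintegral_min_mul_le_setLIntegral_elaplace {G : ℝ → ℝ≥0∞}
    (hG : AEMeasurable G (volume.restrict (Ioi 0))) :
    ENNReal.ofReal (Real.exp (-1)) *
        ∫⁻ r in Ioi (0 : ℝ), ENNReal.ofReal (min 1 r⁻¹) * G r ≤
      ∫⁻ s in Ioc 0 1, elaplace G s := by
  have hswap : ∫⁻ s in Ioc 0 1, elaplace G s = ∫⁻ r in Ioi (0 : ℝ), ∫⁻ s in Ioc (0 : ℝ) 1,
      ENNReal.ofReal (Real.exp (-(s * r))) * G r :=
    lintegral_lintegral_swap (AEMeasurable.mul (by fun_prop) hG.comp_snd)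
  rw [hswap, ← lintegral_const_mul'' _ (by fun_prop)]
  refine setLIntegral_mono' measurableSet_Ioi fun r (hr : 0 < r) => ?_
  rw [lintegral_mul_const _ (by fun_prop), ← mul_assoc]
  gcongr
  calc ENNReal.ofReal (Real.exp (-1)) * ENNReal.ofReal (min 1 r⁻¹)
      = ∫⁻ _ in Ioc 0 (min 1 r⁻¹), ENNReal.ofReal (Real.exp (-1)) := by
        rw [setLIntegral_const, Real.volume_Ioc, sub_zero]
    _ ≤ ∫⁻ s in Ioc 0 (min 1 r⁻¹), ENNReal.ofReal (Real.exp (-(s * r))) := by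
        refine setLIntegral_mono' measurableSet_Ioc fun s hs => ?_
        gcongr
        exact (le_div_iff₀ hr).1 (by simpa using hs.2.trans (min_le_right _ _))
    _ ≤ ∫⁻ s in Ioc 0 1, ENNReal.ofReal (Real.exp (-(s * r))) :=
        lintegral_mono_set (Ioc_subset_Ioc_right (min_le_left _ _))

theorem elaplace_const {t : ℝ} (ht : 0 < t) (c : ℝ≥0∞) :
    elaplace (fun _ => c) t = ENNReal.ofReal t⁻¹ * c := by
  have hint : IntegrableOn (fun r : ℝ => Real.exp (-(t * r))) (Ioi 0) := by
    simpa only [neg_mul] using integrableOn_exp_mul_Ioi (neg_lt_zero.2 ht) 0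
  have hval : ∫ r in Ioi (0 : ℝ), Real.exp (-(t * r)) = t⁻¹ := by
    simpa [neg_mul] using integral_exp_mul_Ioi (neg_lt_zero.2 ht) 0
  rw [elaplace, lintegral_mul_const _ (by fun_prop), ← hval,
    ofReal_integral_eq_lintegral_ofReal hint (ae_of_all _ fun r => (Real.exp_pos _).le)]

theorem setLIntegral_Ioc_exp_mul_le_of_monotone {D : ℝ → ℝ≥0∞} (hD : Monotone D) {t b : ℝ}
    (ht : 0 ≤ t) (hb : 0 < b) :
    ∫⁻ r in Ioc (b / 2) b, ENNReal.ofReal (Real.exp (-(t * r))) * (D r * ENNReal.ofReal r⁻¹) ≤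
      D b := by
  calc ∫⁻ r in Ioc (b / 2) b, ENNReal.ofReal (Real.exp (-(t * r))) * (D r * ENNReal.ofReal r⁻¹)
      ≤ ∫⁻ r in Ioc (b / 2) b, D b * ENNReal.ofReal r⁻¹ := by
        refine setLIntegral_mono' measurableSet_Ioc fun r hr => ?_
        have hr0 : 0 < r := (half_pos hb).trans hr.1
        refine (mul_le_of_le_one_left zero_le ?_).trans (mul_le_mul_left (hD hr.2) _)
        rw [ENNReal.ofReal_le_one, Real.exp_le_one_iff, neg_nonpos]
        positivity
    _ = D b * ENNReal.ofReal (Real.log 2) := by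
        rw [lintegral_const_mul _ (by fun_prop),
          setLIntegral_ofReal_inv_Ioc (half_pos hb) (half_le_self hb.le), div_div_cancel₀ hb.ne']
    _ ≤ D b := by
        refine mul_le_of_le_one_right zero_le (ENNReal.ofReal_le_one.2 ?_)
        linarith [Real.log_two_lt_d9]

/-- A nondecreasing function `D` on the line for which `D r / r` is nonincreasing on `(0,∞)`; the
functional `K(·, a)` is the motivating example. -/
structure IsQuasiconcave (D : ℝ → ℝ≥0∞) : Prop where
  monotone : Monotone D
  le_mul : ∀ ⦃s t : ℝ⦄, 0 < s → s ≤ t → D t ≤ ENNReal.ofReal (t / s) * D s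

namespace IsQuasiconcave

variable {D : ℝ → ℝ≥0∞}

theorem const_mul (hD : IsQuasiconcave D) (c : ℝ≥0∞) : IsQuasiconcave fun r => c * D r where
  monotone _ _ hst := mul_le_mul_right (hD.monotone hst) c
  le_mul _ _ hs hst := (mul_le_mul_right (hD.le_mul hs hst) c).trans_eq (mul_left_comm _ _ _)

theorem le_two_mul_of_le_two_mul (hD : IsQuasiconcave D) {s t : ℝ} (hs : 0 < s) (hst : t ≤ 2 * s) :
    D t ≤ 2 * D s := by
  refine (hD.monotone hst).trans ((hD.le_mul hs (by linarith)).trans_eq ?_)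
  rw [mul_div_cancel_right₀ _ hs.ne', ENNReal.ofReal_ofNat]

theorem mul_ofReal_inv_le (hD : IsQuasiconcave D) {s t : ℝ} (hs : 0 < s) (hst : s ≤ t) :
    D t * ENNReal.ofReal t⁻¹ ≤ D s * ENNReal.ofReal s⁻¹ := by
  have ht : 0 < t := hs.trans_le hst
  calc D t * ENNReal.ofReal t⁻¹ ≤ ENNReal.ofReal (t / s) * D s * ENNReal.ofReal t⁻¹ := by
        gcongr; exact hD.le_mul hs hst
    _ = D s * ENNReal.ofReal s⁻¹ := by
        rw [mul_right_comm, ← ENNReal.ofReal_mul (by positivity), mul_comm]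
        congr 2
        field_simp

theorem setLIntegral_Ioi_exp_mul_le (hD : IsQuasiconcave D) {t : ℝ} (ht : 0 < t) :
    ∫⁻ r in Ioi t⁻¹, ENNReal.ofReal (Real.exp (-(t * r))) * (D r * ENNReal.ofReal r⁻¹) ≤
      D t⁻¹ := by
  have hti : 0 < t⁻¹ := inv_pos.2 ht
  calc ∫⁻ r in Ioi t⁻¹, ENNReal.ofReal (Real.exp (-(t * r))) * (D r * ENNReal.ofReal r⁻¹)
      ≤ ∫⁻ r in Ioi t⁻¹, ENNReal.ofReal (Real.exp (-(t * r))) * (D t⁻¹ * ENNReal.ofReal t) := by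
        refine setLIntegral_mono' measurableSet_Ioi fun r hr => mul_le_mul_right ?_ _
        simpa only [inv_inv] using hD.mul_ofReal_inv_le hti (le_of_lt hr)
    _ ≤ elaplace (fun _ => D t⁻¹ * ENNReal.ofReal t) t := lintegral_mono_set (Ioi_subset_Ioi hti.le)
    _ = D t⁻¹ := by
        rw [elaplace_const ht, mul_left_comm, ← ENNReal.ofReal_mul hti.le, inv_mul_cancel₀ ht.ne',
          ENNReal.ofReal_one, mul_one]

theorem elaplace_le_two_mul_tsum (hD : IsQuasiconcave D) {t : ℝ} (ht : 0 < t) :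
    elaplace (fun r => D r * ENNReal.ofReal r⁻¹) t ≤ 2 * ∑' k : ℕ, D ((1 / 2) ^ k * t⁻¹) := by
  set b : ℕ → ℝ := fun k => (1 / 2) ^ k * t⁻¹
  have hb (k : ℕ) : 0 < b k := by positivity
  have hcover : Ioi (0 : ℝ) ⊆ Ioi t⁻¹ ∪ ⋃ k : ℕ, Ioc (b k / 2) (b k) := by
    intro r (hr : 0 < r)
    rcases lt_or_ge t⁻¹ r with hlt | hle
    · exact Or.inl hlt
    obtain ⟨n, hn_lt, hn_le⟩ := exists_nat_pow_near_of_lt_one (x := r * t) (y := (1 / 2 : ℝ))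
      (by positivity) ((le_div_iff₀ ht).1 (by rwa [one_div])) (by norm_num) (by norm_num)
    refine Or.inr (mem_iUnion.2 ⟨n, ?_, (le_div_iff₀ ht).2 hn_le⟩)
    calc b n / 2 = (1 / 2) ^ (n + 1) / t := by simp only [b]; ring
      _ < r := (div_lt_iff₀ ht).2 hn_lt
  calc elaplace (fun r => D r * ENNReal.ofReal r⁻¹) t
      ≤ D t⁻¹ + ∑' k, D (b k) := by
        refine (lintegral_mono_set hcover).trans ((lintegral_union_le _ _ _).trans ?_)
        refine add_le_add (hD.setLIntegral_Ioi_exp_mul_le ht) ((lintegral_iUnion_le _ _).trans ?_)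
        exact ENNReal.tsum_le_tsum fun k =>
          setLIntegral_Ioc_exp_mul_le_of_monotone hD.monotone ht.le (hb k)
    _ ≤ 2 * ∑' k, D (b k) := by
        rw [two_mul]
        gcongr
        simpa [b] using ENNReal.le_tsum (f := fun k => D (b k)) 0

end IsQuasiconcave

theorem setLIntegral_lintegral_Ioc_mul_inv (μ : Measure ℝ) [SFinite μ] {H : ℝ → ℝ≥0∞}
    (hH : Measurable H) (c : ℝ) :
    ∫⁻ t in Ioi 0, (∫⁻ r in Ioc 0 (c * t⁻¹), H r) ∂μ =
      ∫⁻ r in Ioi 0, μ.restrict (Ioi 0) (Ioc 0 (c * r⁻¹)) * H r := by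
  have hmeas : MeasurableSet {x : ℝ × ℝ | x.2 ≤ c * x.1⁻¹} :=
    measurableSet_le (by fun_prop) (by fun_prop)
  calc ∫⁻ t in Ioi 0, (∫⁻ r in Ioc 0 (c * t⁻¹), H r) ∂μ
      = ∫⁻ t in Ioi 0, (∫⁻ r in Ioi 0, {x : ℝ × ℝ | x.2 ≤ c * x.1⁻¹}.indicator
          (fun x => H x.2) (t, r)) ∂μ := by
        refine setLIntegral_congr_fun measurableSet_Ioi fun t _ => ?_
        rw [← Ioi_inter_Iic, inter_comm, ← Measure.restrict_restrict measurableSet_Iic,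
          ← lintegral_indicator measurableSet_Iic]
        rfl
    _ = ∫⁻ r in Ioi 0, (∫⁻ t in Ioi 0, {x : ℝ × ℝ | x.2 ≤ c * x.1⁻¹}.indicator
          (fun x => H x.2) (t, r) ∂μ) :=
        lintegral_lintegral_swap ((by fun_prop : Measurable fun x : ℝ × ℝ => H x.2).indicator
          hmeas).aemeasurable
    _ = ∫⁻ r in Ioi 0, μ.restrict (Ioi 0) (Ioc 0 (c * r⁻¹)) * H r := by
        refine setLIntegral_congr_fun measurableSet_Ioi fun r (hr : 0 < r) => ?_
        rw [mul_comm, ← setLIntegral_const, ← lintegral_indicator measurableSet_Ioc]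
        refine setLIntegral_congr_fun measurableSet_Ioi fun t (ht : 0 < t) => ?_
        simp only [indicator_apply, mem_ofPred_eq, mem_Ioc, ht, true_and, ← div_eq_mul_inv,
          le_div_comm₀ hr ht]

theorem IsQuasiconcave.rpow_le_setLIntegral {D : ℝ → ℝ≥0∞} (hD : IsQuasiconcave D) {p : ℝ}
    (hp : 1 ≤ p) {b : ℝ} (hb : 0 < b) :
    D b ^ p ≤ 4 ^ p * ∫⁻ r in Ioc 0 b, D r ^ p * ENNReal.ofReal r⁻¹ := by
  have hp0 : 0 ≤ p := zero_le_one.trans hp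
  have hlog : 1 ≤ 2 ^ p * ENNReal.ofReal (Real.log 2) := by
    calc (1 : ℝ≥0∞) ≤ ENNReal.ofReal (2 * Real.log 2) := by
          rw [ENNReal.one_le_ofReal]
          linarith [Real.log_two_gt_d9]
      _ = 2 ^ (1 : ℝ) * ENNReal.ofReal (Real.log 2) := by
          rw [ENNReal.ofReal_mul zero_le_two, ENNReal.ofReal_ofNat, ENNReal.rpow_one]
      _ ≤ 2 ^ p * ENNReal.ofReal (Real.log 2) := by
          gcongr
          exact one_le_two
  calc D b ^ p ≤ (2 * D (b / 2)) ^ p := by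
        gcongr
        exact hD.le_two_mul_of_le_two_mul (half_pos hb) (by linarith)
    _ ≤ (2 * D (b / 2)) ^ p * (2 ^ p * ENNReal.ofReal (Real.log 2)) := le_mul_of_one_le_right' hlog
    _ = 4 ^ p * (D (b / 2) ^ p * ENNReal.ofReal (Real.log 2)) := by
        rw [show (4 : ℝ≥0∞) = 2 * 2 by norm_num, ENNReal.mul_rpow_of_nonneg _ _ hp0,
          ENNReal.mul_rpow_of_nonneg _ _ hp0]
        ring
    _ = 4 ^ p * ∫⁻ r in Ioc (b / 2) b, D (b / 2) ^ p * ENNReal.ofReal r⁻¹ := by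
        rw [lintegral_const_mul _ (by fun_prop),
          setLIntegral_ofReal_inv_Ioc (half_pos hb) (half_le_self hb.le), div_div_cancel₀ hb.ne']
    _ ≤ 4 ^ p * ∫⁻ r in Ioc (b / 2) b, D r ^ p * ENNReal.ofReal r⁻¹ := by
        gcongr 4 ^ p * ?_
        refine setLIntegral_mono' measurableSet_Ioc fun r hr => ?_
        gcongr
        exact hD.monotone hr.1.le
    _ ≤ 4 ^ p * ∫⁻ r in Ioc 0 b, D r ^ p * ENNReal.ofReal r⁻¹ := by
        gcongr
        exact (half_pos hb).le

instance sFinite_weightMeasure (w : ℝ → ℝ≥0) : SFinite (weightMeasure w) := by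
  unfold weightMeasure; infer_instance

theorem restrict_Ioi_weightMeasure (w : ℝ → ℝ≥0) :
    (weightMeasure w).restrict (Ioi 0) = weightMeasure w := by
  rw [weightMeasure, restrict_withDensity measurableSet_Ioi, Measure.restrict_restrict_of_subset]
  rfl

theorem ae_weightMeasure_pos (w : ℝ → ℝ≥0) : ∀ᵐ t ∂weightMeasure w, 0 < t :=
  (withDensity_absolutelyContinuous _ _).ae_le (ae_restrict_mem measurableSet_Ioi)

theorem weightMeasure_Ioc (w : ℝ → ℝ≥0) (t : ℝ) :
    weightMeasure w (Ioc 0 t) = weightPrimitive w t := by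
  rw [weightMeasure, withDensity_apply _ measurableSet_Ioc,
    Measure.restrict_restrict_of_subset Ioc_subset_Ioi_self, weightPrimitive]

/-- The reverse doubling condition `W(s) ≤ θ W(2s)` on the primitive `W` of a weight; for `θ < 1`
it makes `W(2⁻ᵏ s)` decay geometrically in `k`. -/
def IsReverseDoubling (θ : ℝ≥0∞) (w : ℝ → ℝ≥0) : Prop :=
  ∀ ⦃s : ℝ⦄, 0 < s → weightPrimitive w s ≤ θ * weightPrimitive w (2 * s)

theorem IsReverseDoubling.weightPrimitive_half_pow_mul_le {θ : ℝ≥0∞} {w : ℝ → ℝ≥0}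
    (hw : IsReverseDoubling θ w) (k : ℕ) {s : ℝ} (hs : 0 < s) :
    weightPrimitive w ((1 / 2) ^ k * s) ≤ θ ^ k * weightPrimitive w s := by
  induction k with
  | zero => simp
  | succ k ih =>
    calc weightPrimitive w ((1 / 2) ^ (k + 1) * s)
        ≤ θ * weightPrimitive w (2 * ((1 / 2) ^ (k + 1) * s)) := hw (by positivity)
      _ = θ * weightPrimitive w ((1 / 2) ^ k * s) := by congr 2; ring
      _ ≤ θ * (θ ^ k * weightPrimitive w s) := by gcongr
      _ = θ ^ (k + 1) * weightPrimitive w s := by ring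

theorem interpFunctional_rpow_one_div {p : ℝ} (hp : 0 < p) (φ D : ℝ → ℝ≥0∞) :
    interpFunctional (fun t => φ t ^ (1 / p)) p D =
      (∫⁻ r in Ioi (0 : ℝ), φ r⁻¹ * (D r ^ p * ENNReal.ofReal r⁻¹)) ^ (1 / p) := by
  simp only [interpFunctional, ENNReal.mul_rpow_of_nonneg _ _ hp.le, one_div,
    ENNReal.rpow_inv_rpow hp.ne', mul_assoc]

theorem interpFunctional_const_mul {p : ℝ} (hp : 0 < p) (φ : ℝ → ℝ≥0∞) {c : ℝ≥0∞} (hc : c ≠ ∞)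
    (F : ℝ → ℝ≥0∞) :
    interpFunctional φ p (fun r => c * F r) = c * interpFunctional φ p F := by
  have hcp : c ^ p ≠ ∞ := ENNReal.rpow_ne_top_of_nonneg hp.le hc
  simp only [interpFunctional, mul_left_comm _ c, ENNReal.mul_rpow_of_nonneg _ _ hp.le,
    mul_assoc (c ^ p), lintegral_const_mul' _ _ hcp]
  rw [ENNReal.mul_rpow_of_nonneg _ _ (by positivity), one_div, ENNReal.rpow_rpow_inv hp.ne']

theorem interpFunctional_mono {p : ℝ} (hp : 0 ≤ p) (φ : ℝ → ℝ≥0∞) {F G : ℝ → ℝ≥0∞}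
    (h : ∀ r, 0 < r → F r ≤ G r) : interpFunctional φ p F ≤ interpFunctional φ p G := by
  refine ENNReal.rpow_le_rpow (setLIntegral_mono' measurableSet_Ioi fun r hr => ?_) (by positivity)
  gcongr
  exact h r hr

theorem IsQuasiconcave.eLpNorm_comp_half_pow_mul_inv_le {D : ℝ → ℝ≥0∞} (hD : IsQuasiconcave D)
    {p : ℝ} (hp : 1 ≤ p) {θ : ℝ≥0∞} (hθ : θ ≠ ∞) {w : ℝ → ℝ≥0} (hw : IsReverseDoubling θ w)
    (k : ℕ) :
    eLpNorm (fun t => D ((1 / 2) ^ k * t⁻¹)) (ENNReal.ofReal p) (weightMeasure w) ≤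
      4 * interpFunctional (fun t => weightPrimitive w t ^ (1 / p)) p D * (θ ^ (1 / p)) ^ k := by
  have hp0 : 0 < p := zero_lt_one.trans_le hp
  have hDm : Measurable D := hD.monotone.measurable
  set H : ℝ → ℝ≥0∞ := fun r => D r ^ p * ENNReal.ofReal r⁻¹
  have hH : Measurable H := by fun_prop
  set M := ∫⁻ r in Ioi (0 : ℝ), weightPrimitive w r⁻¹ * H r
  have hint : ∫⁻ t, D ((1 / 2) ^ k * t⁻¹) ^ p ∂weightMeasure w ≤ 4 ^ p * (θ ^ k * M) :=
    calc ∫⁻ t, D ((1 / 2) ^ k * t⁻¹) ^ p ∂weightMeasure w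
        ≤ ∫⁻ t, 4 ^ p * (∫⁻ r in Ioc 0 ((1 / 2) ^ k * t⁻¹), H r) ∂weightMeasure w := by
          refine lintegral_mono_ae ?_
          filter_upwards [ae_weightMeasure_pos w] with t ht
          exact hD.rpow_le_setLIntegral hp (by positivity)
      _ = 4 ^ p * ∫⁻ r in Ioi 0, weightPrimitive w ((1 / 2) ^ k * r⁻¹) * H r := by
          rw [lintegral_const_mul' _ _ (by finiteness), ← restrict_Ioi_weightMeasure,
            setLIntegral_lintegral_Ioc_mul_inv _ hH]
          simp only [restrict_Ioi_weightMeasure, weightMeasure_Ioc]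
      _ ≤ 4 ^ p * ∫⁻ r in Ioi 0, θ ^ k * (weightPrimitive w r⁻¹ * H r) := by
          gcongr 4 ^ p * ?_
          refine setLIntegral_mono' measurableSet_Ioi fun r hr => ?_
          exact (mul_le_mul_left (hw.weightPrimitive_half_pow_mul_le k (inv_pos.2 hr)) _).trans_eq
            (mul_assoc _ _ _)
      _ = 4 ^ p * (θ ^ k * M) := by rw [lintegral_const_mul' _ _ (ENNReal.pow_ne_top hθ)]
  rw [interpFunctional_rpow_one_div hp0, eLpNorm_eq_lintegral_rpow_enorm_toReal (by simpa using hp0)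
    ENNReal.ofReal_ne_top, ENNReal.toReal_ofReal hp0.le]
  simp only [enorm_eq_self]
  calc (∫⁻ t, D ((1 / 2) ^ k * t⁻¹) ^ p ∂weightMeasure w) ^ (1 / p)
      ≤ (4 ^ p * (θ ^ k * M)) ^ (1 / p) := by gcongr
    _ = 4 * M ^ (1 / p) * (θ ^ (1 / p)) ^ k := by
        rw [ENNReal.mul_rpow_of_nonneg _ _ (by positivity),
          ENNReal.mul_rpow_of_nonneg _ _ (by positivity), one_div, ENNReal.rpow_rpow_inv hp0.ne',
          ← ENNReal.rpow_natCast_mul, mul_comm (k : ℝ), ENNReal.rpow_mul_natCast]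
        ring

/-- A bound for the Laplace transform, from quasiconcave functions to `L_p` of a reverse doubling
weight. -/
def laplaceConst (p : ℝ) (θ : ℝ≥0∞) : ℝ≥0∞ := 8 * (1 - θ ^ (1 / p))⁻¹

theorem laplaceConst_ne_top {p : ℝ} (hp : 0 < p) {θ : ℝ≥0∞} (hθ : θ < 1) :
    laplaceConst p θ ≠ ∞ := by
  have hlt : θ ^ (1 / p) < 1 := ENNReal.rpow_lt_one hθ (by positivity)
  exact ENNReal.mul_ne_top (by simp) (ENNReal.inv_ne_top.2 (tsub_pos_of_lt hlt).ne')

theorem IsQuasiconcave.eLpNorm_elaplace_le {D : ℝ → ℝ≥0∞} (hD : IsQuasiconcave D) {p : ℝ}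
    (hp : 1 ≤ p) {θ : ℝ≥0∞} (hθ : θ ≠ ∞) {w : ℝ → ℝ≥0} (hw : IsReverseDoubling θ w) :
    eLpNorm (elaplace fun r => D r * ENNReal.ofReal r⁻¹) (ENNReal.ofReal p) (weightMeasure w) ≤
      laplaceConst p θ * interpFunctional (fun t => weightPrimitive w t ^ (1 / p)) p D := by
  have hDm : Measurable D := hD.monotone.measurable
  set Φ := interpFunctional (fun t => weightPrimitive w t ^ (1 / p)) p D
  calc eLpNorm (elaplace fun r => D r * ENNReal.ofReal r⁻¹) (ENNReal.ofReal p) (weightMeasure w)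
      ≤ 2 * eLpNorm (fun t => ∑' k : ℕ, D ((1 / 2) ^ k * t⁻¹)) (ENNReal.ofReal p)
          (weightMeasure w) := by
        refine eLpNorm_le_mul_eLpNorm_of_ae_le_mul'' _
          (Measurable.tsum fun k => by fun_prop).aestronglyMeasurable ?_
        filter_upwards [ae_weightMeasure_pos w] with t ht
        exact hD.elaplace_le_two_mul_tsum ht
    _ ≤ 2 * ∑' k : ℕ, 4 * Φ * (θ ^ (1 / p)) ^ k := by
        gcongr 2 * ?_
        exact (eLpNorm_tsum_le_tsum (ENNReal.one_le_ofReal.2 hp) fun k => by fun_prop).trans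
          (ENNReal.tsum_le_tsum (hD.eLpNorm_comp_half_pow_mul_inv_le hp hθ hw))
    _ = laplaceConst p θ * Φ := by
        rw [ENNReal.tsum_mul_left, ENNReal.tsum_geometric, laplaceConst]
        ring

theorem rpow_lintegral_le_mul_lintegral_rpow_neg {α : Type*} [MeasurableSpace α] {μ : Measure α}
    {p : ℝ} (hp : 1 < p) {w : α → ℝ≥0} (hw : AEMeasurable w μ) (hw_pos : ∀ᵐ x ∂μ, 0 < w x)
    {F : α → ℝ≥0∞} (hF : AEMeasurable F μ) :
    (∫⁻ x, F x ∂μ) ^ p ≤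
      (∫⁻ x, w x * F x ^ p ∂μ) * (∫⁻ x, (w x : ℝ≥0∞) ^ (-(1 / (p - 1))) ∂μ) ^ (p - 1) := by
  have hp0 : 0 < p := zero_lt_one.trans hp
  have hp1 : 0 < p - 1 := sub_pos.2 hp
  have hpq : p.HolderConjugate p.conjExponent := Real.HolderConjugate.conjExponent hp
  have hq : p.conjExponent = p / (p - 1) := rfl
  have hfactor : ∫⁻ x, F x ∂μ =
      ∫⁻ x, (w x : ℝ≥0∞) ^ (1 / p) * F x * (w x : ℝ≥0∞) ^ (-(1 / p)) ∂μ := by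
    refine lintegral_congr_ae ?_
    filter_upwards [hw_pos] with x hx
    rw [mul_right_comm, ← ENNReal.rpow_add _ _ (by simpa using hx.ne') ENNReal.coe_ne_top,
      add_neg_cancel, ENNReal.rpow_zero, one_mul]
  have hf_pow (x : α) : ((w x : ℝ≥0∞) ^ (1 / p) * F x) ^ p = w x * F x ^ p := by
    rw [ENNReal.mul_rpow_of_nonneg _ _ hp0.le, one_div, ENNReal.rpow_inv_rpow hp0.ne']
  have hg_pow (x : α) : ((w x : ℝ≥0∞) ^ (-(1 / p))) ^ p.conjExponent =
      (w x : ℝ≥0∞) ^ (-(1 / (p - 1))) := by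
    rw [← ENNReal.rpow_mul, hq]
    congr 1
    field_simp
  calc (∫⁻ x, F x ∂μ) ^ p
      ≤ ((∫⁻ x, w x * F x ^ p ∂μ) ^ (1 / p) *
          (∫⁻ x, (w x : ℝ≥0∞) ^ (-(1 / (p - 1))) ∂μ) ^ (1 / p.conjExponent)) ^ p := by
        simp only [hfactor, ← hf_pow, ← hg_pow]
        gcongr
        exact ENNReal.lintegral_mul_le_Lp_mul_Lq μ hpq (by fun_prop) (by fun_prop)
    _ = (∫⁻ x, w x * F x ^ p ∂μ) * (∫⁻ x, (w x : ℝ≥0∞) ^ (-(1 / (p - 1))) ∂μ) ^ (p - 1) := by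
        rw [ENNReal.mul_rpow_of_nonneg _ _ hp0.le, one_div, ENNReal.rpow_inv_rpow hp0.ne',
          ← ENNReal.rpow_mul, hq]
        congr 2
        field_simp

/-- Local integrability on `[0,∞)` of the weight `w^{-1/(p-1)}` dual to `w`; it makes functions in
`L_p(w dt)` integrable up to `0`. -/
def HasLocallyIntegrableDual (p : ℝ) (w : ℝ → ℝ≥0) : Prop :=
  ∀ ⦃t : ℝ⦄, 0 < t → ∫⁻ s in Ioc 0 t, (w s : ℝ≥0∞) ^ (-(1 / (p - 1))) ≠ ∞

theorem HasLocallyIntegrableDual.ae_pos {p : ℝ} (hp : 1 < p) {w : ℝ → ℝ≥0}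
    (hw : HasLocallyIntegrableDual p w) {t : ℝ} (ht : 0 < t)
    (hwm : AEMeasurable w (volume.restrict (Ioc 0 t))) :
    ∀ᵐ s ∂volume.restrict (Ioc 0 t), 0 < w s := by
  filter_upwards [ae_lt_top' (by fun_prop) (hw ht)] with s hs
  have hneg : -(1 / (p - 1)) < 0 := neg_lt_zero.2 (one_div_pos.2 (sub_pos.2 hp))
  refine pos_iff_ne_zero.2 fun h0 => hs.ne ?_
  rw [h0, ENNReal.coe_zero, ENNReal.zero_rpow_of_neg hneg]

theorem HasLocallyIntegrableDual.setLIntegral_ne_top {p : ℝ} (hp : 1 < p) {w : ℝ → ℝ≥0}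
    (hw : HasLocallyIntegrableDual p w) (hwm : AEMeasurable w (volume.restrict (Ioi 0)))
    {F : ℝ → ℝ≥0∞} (hF : AEMeasurable F (volume.restrict (Ioi 0)))
    (hFp : eLpNorm F (ENNReal.ofReal p) (weightMeasure w) ≠ ∞) {t : ℝ} (ht : 0 < t) :
    ∫⁻ s in Ioc 0 t, F s ≠ ∞ := by
  have hp0 : 0 < p := zero_lt_one.trans hp
  have hsub : Ioc 0 t ⊆ Ioi 0 := Ioc_subset_Ioi_self
  have hwt := hwm.mono_set hsub
  have hFw : ∫⁻ s in Ioi 0, w s * F s ^ p ≠ ∞ := by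
    rw [eLpNorm_eq_lintegral_rpow_enorm_toReal (by simpa using hp0) ENNReal.ofReal_ne_top,
      ENNReal.toReal_ofReal hp0.le, weightMeasure,
      lintegral_withDensity_eq_lintegral_mul₀ hwm.coe_nnreal_ennreal (by fun_prop)] at hFp
    exact fun h => hFp (by simpa [h] using hp0)
  have hle := rpow_lintegral_le_mul_lintegral_rpow_neg hp hwt (hw.ae_pos hp ht hwt)
    (hF.mono_set hsub)
  refine fun h => (ENNReal.mul_lt_top (ne_top_of_le_ne_top hFw (lintegral_mono_set hsub)).lt_top
    (ENNReal.rpow_ne_top_of_nonneg (sub_pos.2 hp).le (hw ht)).lt_top).not_ge ?_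
  simpa only [h, ENNReal.top_rpow_of_pos hp0] using hle

theorem lintegral_mul_rpow_le_muckenhouptConst {p : ℝ} (hp : 1 ≤ p) (w : ℝ → ℝ≥0) {a b : ℝ}
    (hab : a < b) :
    (∫⁻ t in Icc a b, (w t : ℝ≥0∞)) *
        (∫⁻ t in Icc a b, (w t : ℝ≥0∞) ^ (-(1 / (p - 1)))) ^ (p - 1) ≤
      muckenhouptConst p w * ENNReal.ofReal (b - a) ^ p := by
  set A := ∫⁻ t in Icc a b, (w t : ℝ≥0∞)
  set S := ∫⁻ t in Icc a b, (w t : ℝ≥0∞) ^ (-(1 / (p - 1)))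
  set L := ENNReal.ofReal (b - a)
  have hL0 : L ≠ 0 := by simp [L, hab]
  have hLtop : L ≠ ∞ := ENNReal.ofReal_ne_top
  calc A * S ^ (p - 1) = (L⁻¹ * L) * A * ((L⁻¹ * L) * S) ^ (p - 1) := by
        rw [ENNReal.inv_mul_cancel hL0 hLtop, one_mul, one_mul]
    _ = (L⁻¹ * A) * (L⁻¹ * S) ^ (p - 1) * (L ^ (1 : ℝ) * L ^ (p - 1)) := by
        simp only [ENNReal.mul_rpow_of_nonneg _ _ (sub_nonneg.2 hp), ENNReal.rpow_one]
        ring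
    _ = (L⁻¹ * A) * (L⁻¹ * S) ^ (p - 1) * L ^ p := by
        rw [← ENNReal.rpow_add _ _ hL0 hLtop, add_sub_cancel]
    _ ≤ muckenhouptConst p w * L ^ p := by
        gcongr
        exact le_iSup_of_le a (le_iSup_of_le b (le_iSup_of_le hab le_rfl))

namespace IsMuckenhoupt

variable {p : ℝ} {w : ℝ → ℝ≥0}

theorem lintegral_Icc_ne_zero (hw : IsMuckenhoupt p w) {a b : ℝ} (hab : a < b) :
    ∫⁻ t in Icc a b, (w t : ℝ≥0∞) ≠ 0 := by
  have hwm : AEMeasurable w (volume.restrict (Icc a b)) := hw.aemeasurable.restrict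
  have : (ae (volume.restrict (Icc a b))).NeBot := ae_restrict_neBot.2 (by simp [hab])
  intro h
  rw [lintegral_eq_zero_iff' (by fun_prop)] at h
  obtain ⟨t, hwt, hwt_pos⟩ := (h.and (ae_restrict_of_ae hw.ae_pos)).exists
  exact hwt_pos.ne' (ENNReal.coe_eq_zero.1 hwt)

theorem hasLocallyIntegrableDual (hp : 1 < p) (hw : IsMuckenhoupt p w) :
    HasLocallyIntegrableDual p w := by
  intro t ht
  have hle := lintegral_mul_rpow_le_muckenhouptConst hp.le w ht
  refine ne_top_of_le_ne_top (fun h => ?_) (lintegral_mono_set Ioc_subset_Icc_self)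
  rw [h, ENNReal.top_rpow_of_pos (sub_pos.2 hp), ENNReal.mul_top (hw.lintegral_Icc_ne_zero ht),
    top_le_iff] at hle
  exact ENNReal.mul_ne_top hw.const_lt_top.ne
    (ENNReal.rpow_ne_top_of_nonneg (by linarith) ENNReal.ofReal_ne_top) hle

theorem weightPrimitive_two_mul_le (hp : 1 < p) (hw : IsMuckenhoupt p w) {s : ℝ} (hs : 0 < s) :
    weightPrimitive w (2 * s) ≤ muckenhouptConst p w * 2 ^ p * ∫⁻ t in Ioc s (2 * s), w t := by
  have hp0 : 0 < p := zero_lt_one.trans hp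
  set A := ∫⁻ t in Icc 0 (2 * s), (w t : ℝ≥0∞)
  set E := ∫⁻ t in Ioc s (2 * s), (w t : ℝ≥0∞)
  set S := ∫⁻ t in Icc 0 (2 * s), (w t : ℝ≥0∞) ^ (-(1 / (p - 1)))
  have hE : ENNReal.ofReal s ^ p ≤ E * S ^ (p - 1) :=
    calc ENNReal.ofReal s ^ p = (∫⁻ _ in Ioc s (2 * s), 1) ^ p := by
          rw [setLIntegral_one, Real.volume_Ioc]
          ring_nf
      _ ≤ E * (∫⁻ t in Ioc s (2 * s), (w t : ℝ≥0∞) ^ (-(1 / (p - 1)))) ^ (p - 1) := by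
          simpa only [ENNReal.one_rpow, mul_one] using rpow_lintegral_le_mul_lintegral_rpow_neg hp
            hw.aemeasurable.restrict (ae_restrict_of_ae hw.ae_pos) (F := fun _ => 1) (by fun_prop)
      _ ≤ E * S ^ (p - 1) := by
          gcongr
          exact lintegral_mono_set fun x hx => ⟨hs.le.trans hx.1.le, hx.2⟩
  have hA : A * S ^ (p - 1) ≤ muckenhouptConst p w * (2 ^ p * ENNReal.ofReal s ^ p) := by
    simpa only [sub_zero, ENNReal.ofReal_mul zero_le_two, ENNReal.ofReal_ofNat,
      ENNReal.mul_rpow_of_nonneg _ _ hp0.le]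
      using lintegral_mul_rpow_le_muckenhouptConst hp.le w (mul_pos two_pos hs)
  have hs_ne : ENNReal.ofReal s ^ p ≠ 0 := by simp [hs]
  have hs_ne_top : ENNReal.ofReal s ^ p ≠ ∞ :=
    ENNReal.rpow_ne_top_of_nonneg hp0.le ENNReal.ofReal_ne_top
  refine (lintegral_mono_set Ioc_subset_Icc_self).trans ?_
  rw [← ENNReal.mul_le_mul_iff_left hs_ne hs_ne_top]
  calc A * ENNReal.ofReal s ^ p ≤ A * (E * S ^ (p - 1)) := by gcongr
    _ = A * S ^ (p - 1) * E := by ring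
    _ ≤ muckenhouptConst p w * (2 ^ p * ENNReal.ofReal s ^ p) * E := by gcongr
    _ = muckenhouptConst p w * 2 ^ p * E * ENNReal.ofReal s ^ p := by ring

end IsMuckenhoupt

/-- The ratio in the reverse doubling condition for a weight with `A_p` constant `q`. -/
def reverseDoublingRatio (p : ℝ) (q : ℝ≥0∞) : ℝ≥0∞ := q * 2 ^ p / (q * 2 ^ p + 1)

theorem reverseDoublingRatio_lt_one {p : ℝ} (hp : 0 ≤ p) {q : ℝ≥0∞} (hq : q ≠ ∞) :
    reverseDoublingRatio p q < 1 := by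
  refine ENNReal.div_lt_of_lt_mul ?_
  rw [one_mul]
  exact ENNReal.lt_add_right
    (ENNReal.mul_ne_top hq (ENNReal.rpow_ne_top_of_nonneg hp (by simp))) one_ne_zero

theorem IsMuckenhoupt.isReverseDoubling {p : ℝ} (hp : 1 < p) {w : ℝ → ℝ≥0}
    (hw : IsMuckenhoupt p w) :
    IsReverseDoubling (reverseDoublingRatio p (muckenhouptConst p w)) w := by
  intro s hs
  set c := muckenhouptConst p w * 2 ^ p
  have hc : c ≠ ∞ := ENNReal.mul_ne_top hw.const_lt_top.ne
    (ENNReal.rpow_ne_top_of_nonneg (by linarith) (by simp))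
  set E := ∫⁻ t in Ioc s (2 * s), (w t : ℝ≥0∞)
  have hsplit : weightPrimitive w (2 * s) = weightPrimitive w s + E := by
    rw [weightPrimitive, ← Ioc_union_Ioc_eq_Ioc hs.le (by linarith : s ≤ 2 * s),
      lintegral_union measurableSet_Ioc (Ioc_disjoint_Ioc_of_le le_rfl), weightPrimitive]
  have hmul : (c + 1) * weightPrimitive w s ≤ c * weightPrimitive w (2 * s) :=
    calc (c + 1) * weightPrimitive w s = c * weightPrimitive w s + weightPrimitive w s := by ring
      _ ≤ c * weightPrimitive w s + c * E := by
          gcongr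
          exact (hsplit.symm ▸ le_self_add).trans (hw.weightPrimitive_two_mul_le hp hs)
      _ = c * weightPrimitive w (2 * s) := by rw [hsplit, mul_add]
  calc weightPrimitive w s ≤ c * weightPrimitive w (2 * s) / (c + 1) := by
        rwa [ENNReal.le_div_iff_mul_le (by simp) (by simp [hc]), mul_comm]
    _ = c / (c + 1) * weightPrimitive w (2 * s) := ENNReal.mul_div_right_comm

theorem floor_logb_two_eq_iff {r : ℝ} (hr : 0 < r) (n : ℤ) :
    ⌊Real.logb 2 r⌋ = n ↔ r ∈ Ico ((2 : ℝ) ^ n) (2 ^ (n + 1)) := by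
  rw [Int.floor_eq_iff, Real.le_logb_iff_rpow_le one_lt_two hr, ← Int.cast_one, ← Int.cast_add,
    Real.logb_lt_iff_lt_rpow one_lt_two hr, Real.rpow_intCast, Real.rpow_intCast, mem_Ico]

theorem iUnion_Ico_two_zpow : ⋃ n : ℤ, Ico ((2 : ℝ) ^ n) (2 ^ (n + 1)) = Ioi 0 := by
  ext r
  simp only [mem_iUnion, mem_Ioi]
  exact ⟨fun ⟨n, hn⟩ => (by positivity : (0 : ℝ) < 2 ^ n).trans_le hn.1,
    fun hr => ⟨_, (floor_logb_two_eq_iff hr _).1 rfl⟩⟩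

theorem pairwise_disjoint_Ico_two_zpow :
    Pairwise (Function.onFun Disjoint fun n : ℤ => Ico ((2 : ℝ) ^ n) (2 ^ (n + 1))) := by
  refine fun m n hmn => Set.disjoint_left.2 fun r hm hn => hmn ?_
  have hr : 0 < r := (by positivity : (0 : ℝ) < 2 ^ m).trans_le hm.1
  rw [← (floor_logb_two_eq_iff hr m).2 hm, (floor_logb_two_eq_iff hr n).2 hn]

theorem setLIntegral_ofReal_inv_Ico_two_zpow (n : ℤ) :
    ∫⁻ r in Ico ((2 : ℝ) ^ n) (2 ^ (n + 1)), ENNReal.ofReal r⁻¹ = ENNReal.ofReal (Real.log 2) := by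
  have hn : (0 : ℝ) < 2 ^ n := by positivity
  rw [setLIntegral_congr Ico_ae_eq_Ioc, setLIntegral_ofReal_inv_Ioc hn
    (zpow_le_zpow_right₀ one_le_two (by lia)), zpow_add_one₀ two_ne_zero,
    mul_div_cancel_left₀ _ hn.ne']

theorem tsum_le_two_mul_lintegral_of_le_on_Ico_two_zpow {c : ℤ → ℝ≥0∞} {H : ℝ → ℝ≥0∞}
    (h : ∀ n : ℤ, ∀ r ∈ Ico ((2 : ℝ) ^ n) (2 ^ (n + 1)), c n ≤ H r) :
    ∑' n, c n ≤ 2 * ∫⁻ r in Ioi (0 : ℝ), H r * ENNReal.ofReal r⁻¹ := by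
  have hlog : 1 ≤ 2 * ENNReal.ofReal (Real.log 2) := by
    rw [← ENNReal.ofReal_ofNat 2, ← ENNReal.ofReal_mul zero_le_two, ENNReal.one_le_ofReal]
    linarith [Real.log_two_gt_d9]
  rw [← iUnion_Ico_two_zpow, lintegral_iUnion (fun _ => measurableSet_Ico)
    pairwise_disjoint_Ico_two_zpow, ← ENNReal.tsum_mul_left]
  refine ENNReal.tsum_le_tsum fun n => ?_
  calc c n ≤ c n * (2 * ENNReal.ofReal (Real.log 2)) := le_mul_of_one_le_right' hlog
    _ = 2 * ∫⁻ r in Ico ((2 : ℝ) ^ n) (2 ^ (n + 1)), c n * ENNReal.ofReal r⁻¹ := by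
        rw [lintegral_const_mul _ (by fun_prop), setLIntegral_ofReal_inv_Ico_two_zpow,
          mul_left_comm]
    _ ≤ 2 * ∫⁻ r in Ico ((2 : ℝ) ^ n) (2 ^ (n + 1)), H r * ENNReal.ofReal r⁻¹ := by
        gcongr 2 * ?_
        exact setLIntegral_mono' measurableSet_Ico fun r hr => mul_le_mul_left (h n r hr) _

theorem min_one_inv_le_two_mul {s t : ℝ} (hs : 0 < s) (ht : 0 < t) (hts : t ≤ 2 * s) :
    min 1 s⁻¹ ≤ 2 * min 1 t⁻¹ := by
  have hinv : s⁻¹ ≤ 2 * t⁻¹ := by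
    rw [← div_eq_mul_inv, le_div_iff₀ ht]
    calc s⁻¹ * t ≤ s⁻¹ * (2 * s) := by gcongr
      _ = 2 := by field_simp
  rw [mul_min_of_nonneg _ _ zero_le_two]
  exact min_le_min (by norm_num) hinv

namespace IsQuasiconcave

variable {D : ℝ → ℝ≥0∞}

theorem tsum_min_mul_two_zpow_ne_top (hD : IsQuasiconcave D)
    (h : ∫⁻ r in Ioi (0 : ℝ), ENNReal.ofReal (min 1 r⁻¹) * (D r * ENNReal.ofReal r⁻¹) ≠ ∞) :
    ∑' n : ℤ, ENNReal.ofReal (min 1 ((2 : ℝ) ^ n)⁻¹) * D (2 ^ n) ≠ ∞ := by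
  refine ne_top_of_le_ne_top ?_ (tsum_le_two_mul_lintegral_of_le_on_Ico_two_zpow
    (H := fun r => 2 * (ENNReal.ofReal (min 1 r⁻¹) * D r)) fun n r hr => ?_)
  · simp only [mul_assoc, lintegral_const_mul' _ _ ENNReal.ofNat_ne_top]
    exact ENNReal.mul_ne_top ENNReal.ofNat_ne_top (ENNReal.mul_ne_top ENNReal.ofNat_ne_top h)
  · have hn : (0 : ℝ) < 2 ^ n := by positivity
    have hr2 : r ≤ 2 * 2 ^ n := by
      rw [mul_comm, ← zpow_add_one₀ two_ne_zero]
      exact hr.2.le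
    rw [← mul_assoc]
    gcongr
    · rw [← ENNReal.ofReal_ofNat 2, ← ENNReal.ofReal_mul zero_le_two]
      exact ENNReal.ofReal_le_ofReal (min_one_inv_le_two_mul hn (hn.trans_le hr.1) hr2)
    · exact hD.monotone hr.1

theorem tendsto_two_zpow_atBot (hD : IsQuasiconcave D)
    (h : ∫⁻ r in Ioi (0 : ℝ), ENNReal.ofReal (min 1 r⁻¹) * (D r * ENNReal.ofReal r⁻¹) ≠ ∞) :
    Tendsto (fun n : ℤ => D (2 ^ n)) atBot (𝓝 0) := by
  refine ((ENNReal.tendsto_cofinite_zero_of_tsum_ne_top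
    (hD.tsum_min_mul_two_zpow_ne_top h)).mono_left (Int.cofinite_eq ▸ le_sup_left)).congr' ?_
  filter_upwards [eventually_le_atBot 0] with n hn
  rw [min_eq_left ((one_le_inv₀ (by positivity)).2 (zpow_le_one_of_nonpos₀ one_le_two hn)),
    ENNReal.ofReal_one, one_mul]

theorem tendsto_two_zpow_mul_inv_atTop (hD : IsQuasiconcave D)
    (h : ∫⁻ r in Ioi (0 : ℝ), ENNReal.ofReal (min 1 r⁻¹) * (D r * ENNReal.ofReal r⁻¹) ≠ ∞) :
    Tendsto (fun n : ℤ => ENNReal.ofReal (2 ^ n)⁻¹ * D (2 ^ n)) atTop (𝓝 0) := by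
  refine ((ENNReal.tendsto_cofinite_zero_of_tsum_ne_top
    (hD.tsum_min_mul_two_zpow_ne_top h)).mono_left (Int.cofinite_eq ▸ le_sup_right)).congr' ?_
  filter_upwards [eventually_ge_atTop 0] with n hn
  rw [min_eq_right (inv_le_one_of_one_le₀ (one_le_zpow₀ one_le_two hn))]

end IsQuasiconcave

section DyadicStep

variable {E : Type*} [NormedAddCommGroup E] [NormedSpace ℝ E]

/-- The function equal to `(log 2)⁻¹ • c n` on `[2ⁿ, 2ⁿ⁺¹)`, an interval of mass `log 2` for the
measure `dr/r`; its integral against `dr/r` is `∑ c n`. -/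
def dyadicStep (c : ℤ → E) (r : ℝ) : E := (Real.log 2)⁻¹ • c ⌊Real.logb 2 r⌋

theorem stronglyMeasurable_dyadicStep (c : ℤ → E) : StronglyMeasurable (dyadicStep c) := by
  have hfloor : Measurable fun r : ℝ => ⌊Real.logb 2 r⌋ :=
    Int.measurable_floor.comp (by unfold Real.logb; fun_prop)
  exact (StronglyMeasurable.of_discrete.comp_measurable hfloor).const_smul _

theorem setIntegral_inv_smul_dyadicStep [CompleteSpace E] (c : ℤ → E) (n : ℤ) :
    ∫ r in Ico ((2 : ℝ) ^ n) (2 ^ (n + 1)), r⁻¹ • dyadicStep c r = c n := by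
  have hn (r : ℝ) (hr : r ∈ Ico ((2 : ℝ) ^ n) (2 ^ (n + 1))) : 0 < r :=
    (by positivity : (0 : ℝ) < 2 ^ n).trans_le hr.1
  have hinv : ∫ r in Ico ((2 : ℝ) ^ n) (2 ^ (n + 1)), r⁻¹ = Real.log 2 := by
    rw [integral_eq_lintegral_of_nonneg_ae, setLIntegral_ofReal_inv_Ico_two_zpow,
      ENNReal.toReal_ofReal (Real.log_nonneg one_le_two)]
    · filter_upwards [ae_restrict_mem measurableSet_Ico] with r hr
      exact (inv_pos.2 (hn r hr)).le
    · fun_prop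
  calc ∫ r in Ico ((2 : ℝ) ^ n) (2 ^ (n + 1)), r⁻¹ • dyadicStep c r
      = ∫ r in Ico ((2 : ℝ) ^ n) (2 ^ (n + 1)), r⁻¹ • (Real.log 2)⁻¹ • c n := by
        refine setIntegral_congr_fun measurableSet_Ico fun r hr => ?_
        simp only [dyadicStep, (floor_logb_two_eq_iff (hn r hr) n).2 hr]
    _ = c n := by
        rw [integral_smul_const, hinv, smul_inv_smul₀ (Real.log_pos one_lt_two).ne']

theorem hasSum_integral_dyadicStep [CompleteSpace E] {c : ℤ → E}
    (hc : IntegrableOn (fun r : ℝ => r⁻¹ • dyadicStep c r) (Ioi 0)) :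
    HasSum c (∫ r in Ioi (0 : ℝ), r⁻¹ • dyadicStep c r) := by
  rw [← iUnion_Ico_two_zpow] at hc ⊢
  simpa only [setIntegral_inv_smul_dyadicStep] using
    hasSum_integral_iUnion (fun _ => measurableSet_Ico) pairwise_disjoint_Ico_two_zpow hc

end DyadicStep

theorem eq_sub_of_hasSum_int_sub {E : Type*} [AddCommGroup E] [TopologicalSpace E] [T2Space E]
    [IsTopologicalAddGroup E] {b : ℤ → E} {s l l' : E}
    (hs : HasSum (fun n => b (n + 1) - b n) s) (hl : Tendsto b atTop (𝓝 l))
    (hl' : Tendsto b atBot (𝓝 l')) : s = l - l' := by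
  have htel (N : ℕ) : ∑ n ∈ Finset.Ico (-N : ℤ) N, (b (n + 1) - b n) = b N - b (-N) := by
    rw [← neg_sub (b (-N)), ← Finset.sum_Ico_int_sub, ← Finset.sum_neg_distrib]
    simp only [neg_sub]
  have hcast : Tendsto (fun N : ℕ => (N : ℤ)) atTop atTop := tendsto_natCast_atTop_atTop
  refine tendsto_nhds_unique (hs.comp Finset.tendsto_Ico_neg) ?_
  exact ((hl.comp hcast).sub (hl'.comp (tendsto_neg_atTop_atBot.comp hcast))).congr
    fun N => (htel N).symm

theorem le_ofReal_inv_mul_of_ofReal_mul_le {r : ℝ} (hr : 0 < r) {x y : ℝ≥0∞}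
    (h : ENNReal.ofReal r * x ≤ y) : x ≤ ENNReal.ofReal r⁻¹ * y := by
  rwa [ENNReal.ofReal_inv_of_pos hr, ← ENNReal.mul_le_iff_le_inv (by simpa using hr)
    ENNReal.ofReal_ne_top]

namespace InterpolationCouple

variable {X₀ X₁ Z : Type*}
  [NormedAddCommGroup X₀] [NormedSpace ℝ X₀] [NormedAddCommGroup X₁] [NormedSpace ℝ X₁]
  [AddCommGroup Z] [Module ℝ Z] [TopologicalSpace Z] [IsTopologicalAddGroup Z]
  (C : InterpolationCouple X₀ X₁ Z)

theorem ofInter_eq_inl (x : C.interSpace) : C.ofInter x = C.inl (x : X₀ × X₁).1 := rfl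

theorem exists_eq_inl_add_inr (a : C.SumSpace) : ∃ x₀ x₁, a = C.inl x₀ + C.inr x₁ := by
  obtain ⟨x, rfl⟩ := Submodule.Quotient.mk_surjective _ a
  exact ⟨_, _, C.mk_eq_inl_add_inr x⟩

theorem sub_mem_interSpace {x₀ y₀ : X₀} {x₁ y₁ : X₁}
    (h : C.inl x₀ + C.inr x₁ = C.inl y₀ + C.inr y₁) : (y₀ - x₀, x₁ - y₁) ∈ C.interSpace := by
  have hZ := congrArg C.toZ h
  simp only [map_add, toZ_inl, toZ_inr] at hZ
  rw [mem_interSpace, map_sub, map_sub, sub_eq_sub_iff_add_eq_add, ← hZ, add_comm]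

theorem le_K_iff {t : ℝ} {a : C.SumSpace} {c : ℝ≥0∞} :
    c ≤ C.K t a ↔ ∀ x₀ x₁, a = C.inl x₀ + C.inr x₁ → c ≤ ‖x₀‖ₑ + ENNReal.ofReal t * ‖x₁‖ₑ := by
  simp only [K, le_iInf_iff]

theorem K_le {a : C.SumSpace} {x₀ : X₀} {x₁ : X₁} (h : a = C.inl x₀ + C.inr x₁) (t : ℝ) :
    C.K t a ≤ ‖x₀‖ₑ + ENNReal.ofReal t * ‖x₁‖ₑ :=
  C.le_K_iff.1 le_rfl x₀ x₁ h

theorem K_ne_top (t : ℝ) (a : C.SumSpace) : C.K t a ≠ ∞ := by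
  obtain ⟨x₀, x₁, h⟩ := C.exists_eq_inl_add_inr a
  exact ne_top_of_le_ne_top (by finiteness) (C.K_le h t)

theorem isQuasiconcave_K (a : C.SumSpace) : IsQuasiconcave fun t => C.K t a where
  monotone s t hst := C.le_K_iff.2 fun x₀ x₁ h => (C.K_le h s).trans (by gcongr)
  le_mul s t hs hst := by
    have hts : 0 < t / s := div_pos (hs.trans_le hst) hs
    rw [← inv_inv (t / s)]
    refine le_ofReal_inv_mul_of_ofReal_mul_le (inv_pos.2 hts) (C.le_K_iff.2 fun x₀ x₁ h => ?_)
    calc ENNReal.ofReal (t / s)⁻¹ * C.K t a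
        ≤ ENNReal.ofReal (t / s)⁻¹ * (‖x₀‖ₑ + ENNReal.ofReal t * ‖x₁‖ₑ) := by
          gcongr
          exact C.K_le h t
      _ = ENNReal.ofReal (t / s)⁻¹ * ‖x₀‖ₑ + ENNReal.ofReal s * ‖x₁‖ₑ := by
          rw [mul_add, ← mul_assoc, ← ENNReal.ofReal_mul (inv_pos.2 hts).le, inv_div,
            div_mul_cancel₀ _ (hs.trans_le hst).ne']
      _ ≤ ‖x₀‖ₑ + ENNReal.ofReal s * ‖x₁‖ₑ := by
          gcongr
          refine mul_le_of_le_one_left zero_le (ENNReal.ofReal_le_one.2 ?_)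
          exact inv_le_one_of_one_le₀ ((one_le_div hs).2 hst)

theorem monotone_J (x : C.interSpace) : Monotone fun t => C.J t x :=
  fun s t hst => max_le_max le_rfl (by gcongr)

theorem J_smul (c t : ℝ) (x : C.interSpace) : C.J t (c • x) = ‖c‖ₑ * C.J t x := by
  simp only [J, Submodule.coe_smul, Prod.smul_fst, Prod.smul_snd, enorm_smul, mul_max,
    mul_left_comm]

theorem J_sub_le {x₀ y₀ : X₀} {x₁ y₁ : X₁} (h : (y₀ - x₀, x₁ - y₁) ∈ C.interSpace) (t : ℝ) :
    C.J t ⟨(y₀ - x₀, x₁ - y₁), h⟩ ≤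
      (‖x₀‖ₑ + ENNReal.ofReal t * ‖x₁‖ₑ) + (‖y₀‖ₑ + ENNReal.ofReal t * ‖y₁‖ₑ) := by
  refine max_le ?_ ?_
  · calc ‖y₀ - x₀‖ₑ ≤ ‖x₀‖ₑ + ‖y₀‖ₑ := enorm_sub_le.trans_eq (add_comm _ _)
      _ ≤ _ := add_le_add le_self_add le_self_add
  · calc ENNReal.ofReal t * ‖x₁ - y₁‖ₑ ≤ ENNReal.ofReal t * ‖x₁‖ₑ + ENNReal.ofReal t * ‖y₁‖ₑ := by
          rw [← mul_add]
          gcongr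
          exact enorm_sub_le
      _ ≤ _ := add_le_add le_add_self le_add_self

theorem enorm_fst_le_J (t : ℝ) (x : C.interSpace) : ‖(x : X₀ × X₁).1‖ₑ ≤ C.J t x :=
  le_max_left _ _

theorem enorm_snd_le_J {t : ℝ} (ht : 0 < t) (x : C.interSpace) :
    ‖(x : X₀ × X₁).2‖ₑ ≤ ENNReal.ofReal t⁻¹ * C.J t x :=
  le_ofReal_inv_mul_of_ofReal_mul_le ht (le_max_right _ _)

theorem J_dyadicStep_le {D : ℝ → ℝ≥0∞} (hD : Monotone D) {y : ℤ → C.interSpace}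
    (hy : ∀ n : ℤ, C.J (2 ^ (n + 1)) (y n) ≤ D (2 ^ n)) {r : ℝ} (hr : 0 < r) :
    C.J r (dyadicStep y r) ≤ 2 * D r := by
  obtain ⟨hnr, hrn⟩ := (floor_logb_two_eq_iff hr _).1 rfl
  have hlog : ‖(Real.log 2)⁻¹‖ₑ ≤ 2 := by
    rw [Real.enorm_of_nonneg (inv_nonneg.2 (Real.log_nonneg one_le_two)), ← ENNReal.ofReal_ofNat 2]
    refine ENNReal.ofReal_le_ofReal ?_
    rw [inv_le_comm₀ (Real.log_pos one_lt_two) two_pos]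
    linarith [Real.log_two_gt_d9]
  rw [dyadicStep, J_smul]
  gcongr
  exact (C.monotone_J _ hrn.le).trans ((hy _).trans (hD hnr))

section Topology

variable [T2Space Z]

theorem norm_inl_le (x : X₀) : ‖C.inl x‖ ≤ ‖x‖ := by
  rw [norm_eq_sInf]
  refine csInf_le ⟨0, ?_⟩ ⟨x, 0, by simp, by simp⟩
  rintro r ⟨x₀, x₁, -, rfl⟩
  positivity

theorem norm_inr_le (x : X₁) : ‖C.inr x‖ ≤ ‖x‖ := by
  rw [norm_eq_sInf]
  refine csInf_le ⟨0, ?_⟩ ⟨0, x, by simp, by simp⟩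
  rintro r ⟨x₀, x₁, -, rfl⟩
  positivity

/-- The embedding `X₀ ⊆ X₀ + X₁` as a bounded operator. -/
def inlL : X₀ →L[ℝ] C.SumSpace :=
  C.inl.mkContinuous 1 fun x => by simpa using C.norm_inl_le x

/-- The embedding `X₁ ⊆ X₀ + X₁` as a bounded operator. -/
def inrL : X₁ →L[ℝ] C.SumSpace :=
  C.inr.mkContinuous 1 fun x => by simpa using C.norm_inr_le x

@[simp] theorem inlL_apply (x : X₀) : C.inlL x = C.inl x := rfl

@[simp] theorem inrL_apply (x : X₁) : C.inrL x = C.inr x := rfl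

theorem enorm_inl_le (x : X₀) : ‖C.inl x‖ₑ ≤ ‖x‖ₑ :=
  enorm_le_iff_norm_le.2 (C.norm_inl_le x)

theorem enorm_inr_le (x : X₁) : ‖C.inr x‖ₑ ≤ ‖x‖ₑ :=
  enorm_le_iff_norm_le.2 (C.norm_inr_le x)

theorem continuous_ofInter : Continuous C.ofInter :=
  C.inlL.continuous.comp (continuous_fst.comp continuous_subtype_val)

theorem enorm_ofInter_le {r : ℝ} (hr : 0 < r) (x : C.interSpace) :
    ‖C.ofInter x‖ₑ ≤ ENNReal.ofReal (min 1 r⁻¹) * C.J r x := by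
  have hinl : ‖C.ofInter x‖ₑ ≤ C.J r x := (C.enorm_inl_le _).trans (C.enorm_fst_le_J r x)
  have hinr : ‖C.ofInter x‖ₑ ≤ ENNReal.ofReal r⁻¹ * C.J r x :=
    C.ofInter_eq_inr x ▸ (C.enorm_inr_le _).trans (C.enorm_snd_le_J hr x)
  rcases min_choice (1 : ℝ) r⁻¹ with h | h <;> rw [h]
  · rwa [ENNReal.ofReal_one, one_mul]
  · exact hinr

theorem ofReal_min_mul_enorm_le_K (t : ℝ) (a : C.SumSpace) :
    ENNReal.ofReal (min 1 t) * ‖a‖ₑ ≤ C.K t a := by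
  refine C.le_K_iff.2 fun x₀ x₁ h => ?_
  calc ENNReal.ofReal (min 1 t) * ‖a‖ₑ
      ≤ ENNReal.ofReal (min 1 t) * ‖x₀‖ₑ + ENNReal.ofReal (min 1 t) * ‖x₁‖ₑ := by
        rw [h, ← mul_add]
        gcongr
        have hadd := enorm_add_le (C.inl x₀) (C.inr x₁)
        exact hadd.trans (add_le_add (C.enorm_inl_le _) (C.enorm_inr_le _))
    _ ≤ ‖x₀‖ₑ + ENNReal.ofReal t * ‖x₁‖ₑ := by
        gcongr
        · exact mul_le_of_le_one_left zero_le (ENNReal.ofReal_le_one.2 (min_le_left _ _))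
        · exact min_le_right _ _

theorem K_ne_zero {t : ℝ} (ht : 0 < t) {a : C.SumSpace} (ha : a ≠ 0) : C.K t a ≠ 0 := by
  have ha' : ‖a‖ₑ ≠ 0 := by simpa [enorm_eq_nnnorm] using ha
  refine ne_bot_of_le_ne_bot (mul_ne_zero ?_ ha') (C.ofReal_min_mul_enorm_le_K t a)
  simpa using ht

theorem exists_decomposition {t : ℝ} (ht : 0 < t) (a : C.SumSpace) :
    ∃ x₀ x₁, a = C.inl x₀ + C.inr x₁ ∧ ‖x₀‖ₑ + ENNReal.ofReal t * ‖x₁‖ₑ ≤ 2 * C.K t a := by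
  rcases eq_or_ne a 0 with rfl | ha
  · exact ⟨0, 0, by simp, by simp⟩
  · have hlt : C.K t a < 2 * C.K t a := by
      rw [two_mul]
      exact ENNReal.lt_add_right (C.K_ne_top t a) (C.K_ne_zero ht ha)
    by_contra! h
    exact hlt.not_ge (C.le_K_iff.2 fun x₀ x₁ hx => (h x₀ x₁ hx).le)

theorem integrableOn_inv_smul_ofInter {v : ℝ → C.interSpace} {F : ℝ → ℝ≥0∞}
    (hv : AEStronglyMeasurable v (volume.restrict (Ioi 0)))
    (hvF : ∀ r, 0 < r → C.J r (v r) ≤ F r)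
    (hF : ∫⁻ r in Ioi (0 : ℝ), ENNReal.ofReal (min 1 r⁻¹) * (F r * ENNReal.ofReal r⁻¹) ≠ ∞) :
    IntegrableOn (fun r : ℝ => r⁻¹ • C.ofInter (v r)) (Ioi 0) := by
  refine ⟨measurable_inv.aestronglyMeasurable.smul
    (C.continuous_ofInter.comp_aestronglyMeasurable hv), ?_⟩
  refine (setLIntegral_mono' measurableSet_Ioi fun r (hr : 0 < r) => ?_).trans_lt hF.lt_top
  calc ‖r⁻¹ • C.ofInter (v r)‖ₑ
      ≤ ENNReal.ofReal r⁻¹ * (ENNReal.ofReal (min 1 r⁻¹) * F r) := by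
        rw [enorm_smul, Real.enorm_of_nonneg (inv_nonneg.2 hr.le)]
        gcongr
        exact (C.enorm_ofInter_le hr _).trans (mul_le_mul_right (hvF r hr) _)
    _ = ENNReal.ofReal (min 1 r⁻¹) * (F r * ENNReal.ofReal r⁻¹) := by ring

theorem exists_dyadic_decomposition (a : C.SumSpace) :
    ∃ (x : ℤ → X₀ × X₁) (y : ℤ → C.interSpace),
      (∀ n, a = C.inl (x n).1 + C.inr (x n).2) ∧
      (∀ n, ‖(x n).1‖ₑ + ENNReal.ofReal (2 ^ n) * ‖(x n).2‖ₑ ≤ 2 * C.K (2 ^ n) a) ∧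
      (∀ n, C.ofInter (y n) = C.inl (x (n + 1)).1 - C.inl (x n).1) ∧
      ∀ n, C.J (2 ^ (n + 1)) (y n) ≤ 8 * C.K (2 ^ n) a := by
  have hpos (n : ℤ) : (0 : ℝ) < 2 ^ n := by positivity
  have hsucc (n : ℤ) : (2 : ℝ) ^ (n + 1) = 2 * 2 ^ n := by rw [zpow_add_one₀ two_ne_zero, mul_comm]
  choose x₀ x₁ hx hle using fun n : ℤ => C.exists_decomposition (hpos n) a
  refine ⟨fun n => (x₀ n, x₁ n),
    fun n => ⟨_, C.sub_mem_interSpace ((hx n).symm.trans (hx (n + 1)))⟩, hx, hle,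
    fun n => map_sub C.inl _ _, fun n => ?_⟩
  have hn : ‖x₀ n‖ₑ + ENNReal.ofReal (2 ^ (n + 1)) * ‖x₁ n‖ₑ ≤ 4 * C.K (2 ^ n) a :=
    calc ‖x₀ n‖ₑ + ENNReal.ofReal (2 ^ (n + 1)) * ‖x₁ n‖ₑ
        ≤ 2 * ‖x₀ n‖ₑ + 2 * (ENNReal.ofReal (2 ^ n) * ‖x₁ n‖ₑ) := by
          rw [hsucc, ENNReal.ofReal_mul zero_le_two, ENNReal.ofReal_ofNat, mul_assoc]
          gcongr
          exact le_mul_of_one_le_left' one_le_two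
      _ ≤ 2 * (2 * C.K (2 ^ n) a) := by
          rw [← mul_add]
          gcongr
          exact hle n
      _ = 4 * C.K (2 ^ n) a := by ring
  have hn1 : ‖x₀ (n + 1)‖ₑ + ENNReal.ofReal (2 ^ (n + 1)) * ‖x₁ (n + 1)‖ₑ ≤ 4 * C.K (2 ^ n) a :=
    calc ‖x₀ (n + 1)‖ₑ + ENNReal.ofReal (2 ^ (n + 1)) * ‖x₁ (n + 1)‖ₑ
        ≤ 2 * (2 * C.K (2 ^ n) a) := by
          refine (hle (n + 1)).trans ?_
          gcongr
          exact (C.isQuasiconcave_K a).le_two_mul_of_le_two_mul (hpos n) (hsucc n).le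
      _ = 4 * C.K (2 ^ n) a := by ring
  calc C.J (2 ^ (n + 1)) ⟨(x₀ (n + 1) - x₀ n, x₁ n - x₁ (n + 1)), _⟩
      ≤ 4 * C.K (2 ^ n) a + 4 * C.K (2 ^ n) a := (C.J_sub_le _ _).trans (add_le_add hn hn1)
    _ = 8 * C.K (2 ^ n) a := by ring

theorem summable_ofInter [CompleteSpace X₀] [CompleteSpace X₁] {D : ℝ → ℝ≥0∞}
    (hD : ∑' n : ℤ, ENNReal.ofReal (min 1 ((2 : ℝ) ^ n)⁻¹) * D (2 ^ n) ≠ ∞) {y : ℤ → C.interSpace}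
    (hy : ∀ n : ℤ, C.J (2 ^ n) (y n) ≤ D (2 ^ n)) : Summable fun n => C.ofInter (y n) := by
  refine .of_enorm (ne_top_of_le_ne_top hD (ENNReal.tsum_le_tsum fun n => ?_))
  exact (C.enorm_ofInter_le (by positivity) _).trans (mul_le_mul_right (hy n) _)

theorem exists_hasSum_ofInter [CompleteSpace X₀] [CompleteSpace X₁] (a : C.SumSpace)
    (ha : ∫⁻ r in Ioi (0 : ℝ), ENNReal.ofReal (min 1 r⁻¹) * (C.K r a * ENNReal.ofReal r⁻¹) ≠ ∞) :
    ∃ y : ℤ → C.interSpace, HasSum (fun n => C.ofInter (y n)) a ∧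
      ∀ n : ℤ, C.J (2 ^ (n + 1)) (y n) ≤ 8 * C.K (2 ^ n) a := by
  obtain ⟨x, y, hx, hxK, hyx, hyK⟩ := C.exists_dyadic_decomposition a
  refine ⟨y, ?_, hyK⟩
  have hK := C.isQuasiconcave_K a
  have hsum : Summable fun n => C.ofInter (y n) := by
    refine C.summable_ofInter (D := fun r => 8 * C.K r a) ?_ fun n =>
      (C.monotone_J _ (zpow_le_zpow_right₀ one_le_two (by lia))).trans (hyK n)
    simp only [mul_left_comm _ (8 : ℝ≥0∞), ENNReal.tsum_mul_left]
    exact ENNReal.mul_ne_top ENNReal.ofNat_ne_top (hK.tsum_min_mul_two_zpow_ne_top ha)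
  have hinl : Tendsto (fun n => C.inl (x n).1) atBot (𝓝 0) := by
    rw [tendsto_zero_iff_enorm_tendsto_zero]
    refine tendsto_of_tendsto_of_tendsto_of_le_of_le tendsto_const_nhds
      (mul_zero (2 : ℝ≥0∞) ▸ ENNReal.Tendsto.const_mul (hK.tendsto_two_zpow_atBot ha)
        (.inr ENNReal.ofNat_ne_top)) (fun _ => zero_le) fun n => ?_
    exact (C.enorm_inl_le _).trans (le_self_add.trans (hxK n))
  have hinr : Tendsto (fun n => C.inr (x n).2) atTop (𝓝 0) := by
    rw [tendsto_zero_iff_enorm_tendsto_zero]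
    refine tendsto_of_tendsto_of_tendsto_of_le_of_le tendsto_const_nhds
      (mul_zero (2 : ℝ≥0∞) ▸ ENNReal.Tendsto.const_mul (hK.tendsto_two_zpow_mul_inv_atTop ha)
        (.inr ENNReal.ofNat_ne_top)) (fun _ => zero_le) fun n => ?_
    refine (C.enorm_inr_le _).trans ((le_ofReal_inv_mul_of_ofReal_mul_le (by positivity)
      (le_add_self.trans (hxK n))).trans_eq (mul_left_comm _ _ _))
  have hinl' : Tendsto (fun n => C.inl (x n).1) atTop (𝓝 a) := by
    have hlim := (tendsto_const_nhds (x := a)).sub hinr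
    rw [sub_zero] at hlim
    exact hlim.congr fun n => sub_eq_of_eq_add (hx n)
  have htsum : ∑' n, C.ofInter (y n) = a - 0 :=
    eq_sub_of_hasSum_int_sub (by simpa only [hyx] using hsum.hasSum) hinl' hinl
  simpa only [htsum, sub_zero] using hsum.hasSum

theorem exists_isJRepresentation [CompleteSpace X₀] [CompleteSpace X₁] (a : C.SumSpace)
    (ha : ∫⁻ r in Ioi (0 : ℝ), ENNReal.ofReal (min 1 r⁻¹) * (C.K r a * ENNReal.ofReal r⁻¹) ≠ ∞) :
    ∃ v : ℝ → C.interSpace, C.IsJRepresentation v a ∧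
      ∀ r, 0 < r → C.J r (v r) ≤ 16 * C.K r a := by
  obtain ⟨y, hya, hyK⟩ := C.exists_hasSum_ofInter a ha
  have hvm := (stronglyMeasurable_dyadicStep y).aestronglyMeasurable (μ := volume.restrict (Ioi 0))
  have hvK (r : ℝ) (hr : 0 < r) : C.J r (dyadicStep y r) ≤ 16 * C.K r a := by
    refine (C.J_dyadicStep_le ((C.isQuasiconcave_K a).const_mul 8).monotone hyK hr).trans_eq ?_
    rw [← mul_assoc]
    norm_num
  have hint := C.integrableOn_inv_smul_ofInter hvm hvK (by
    simp only [mul_assoc, mul_left_comm _ (16 : ℝ≥0∞),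
      lintegral_const_mul' _ _ (ENNReal.ofNat_ne_top (n := 16))]
    exact ENNReal.mul_ne_top ENNReal.ofNat_ne_top ha)
  have hstep (r : ℝ) : C.ofInter (dyadicStep y r) = dyadicStep (fun n => C.ofInter (y n)) r :=
    map_smul C.ofInter _ _
  refine ⟨dyadicStep y, ⟨hvm, hint, hya.unique ?_⟩, hvK⟩
  simp only [hstep] at hint ⊢
  exact hasSum_integral_dyadicStep hint

end Topology

end InterpolationCouple

theorem setIntegral_exp_neg_mul {t r : ℝ} (ht : 0 ≤ t) (hr : r ≠ 0) :
    ∫ s in Ioc 0 t, Real.exp (-(s * r)) = r⁻¹ * (1 - Real.exp (-(t * r))) := by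
  rw [← intervalIntegral.integral_of_le ht,
    intervalIntegral.integral_comp_mul_right (fun x => Real.exp (-x)) hr,
    intervalIntegral.integral_comp_neg, integral_exp, zero_mul, neg_zero, Real.exp_zero,
    smul_eq_mul]

section Laplace

variable {E F : Type*} [NormedAddCommGroup E] [NormedSpace ℝ E] [NormedAddCommGroup F]
  [NormedSpace ℝ F] {g : ℝ → E}

/-- The Laplace transform of a function on `(0,∞)` with values in a Banach space, as a Bochner
integral. -/
def laplace (g : ℝ → E) (t : ℝ) : E := ∫ r in Ioi (0 : ℝ), Real.exp (-(t * r)) • g r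

theorem lintegral_enorm_exp_smul (g : ℝ → E) (t : ℝ) :
    ∫⁻ r in Ioi (0 : ℝ), ‖Real.exp (-(t * r)) • g r‖ₑ = elaplace (fun r => ‖g r‖ₑ) t := by
  simp only [enorm_smul, Real.enorm_of_nonneg (Real.exp_nonneg _), elaplace]

theorem enorm_laplace_le (g : ℝ → E) (t : ℝ) : ‖laplace g t‖ₑ ≤ elaplace (fun r => ‖g r‖ₑ) t :=
  (enorm_integral_le_lintegral_enorm _).trans_eq (lintegral_enorm_exp_smul g t)

theorem laplace_zero (g : ℝ → E) : laplace g 0 = ∫ r in Ioi (0 : ℝ), g r := by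
  simp [laplace]

theorem integrableOn_exp_smul (hg : IntegrableOn g (Ioi 0)) {t : ℝ} (ht : 0 ≤ t) :
    IntegrableOn (fun r : ℝ => Real.exp (-(t * r)) • g r) (Ioi 0) := by
  refine hg.bdd_smul (C := 1) (by fun_prop) ?_
  filter_upwards [ae_restrict_mem measurableSet_Ioi] with r hr
  rw [Real.norm_of_nonneg (Real.exp_nonneg _), Real.exp_le_one_iff, neg_nonpos]
  exact mul_nonneg ht (le_of_lt hr)

theorem integrableOn_exp_smul_of_elaplace_ne_top
    (hg : AEStronglyMeasurable g (volume.restrict (Ioi 0))) {t : ℝ}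
    (ht : elaplace (fun r => ‖g r‖ₑ) t ≠ ∞) :
    IntegrableOn (fun r : ℝ => Real.exp (-(t * r)) • g r) (Ioi 0) :=
  ⟨by fun_prop, (lintegral_enorm_exp_smul g t).trans_lt ht.lt_top⟩

theorem aestronglyMeasurable_prod_exp_smul (hg : AEStronglyMeasurable g (volume.restrict (Ioi 0)))
    (μ : Measure ℝ) : AEStronglyMeasurable (fun z : ℝ × ℝ => Real.exp (-(z.1 * z.2)) • g z.2)
      (μ.prod (volume.restrict (Ioi 0))) :=
  (by fun_prop : Measurable fun z : ℝ × ℝ => Real.exp (-(z.1 * z.2))).aestronglyMeasurable.smul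
    hg.comp_snd

theorem aestronglyMeasurable_laplace (hg : AEStronglyMeasurable g (volume.restrict (Ioi 0)))
    (μ : Measure ℝ) : AEStronglyMeasurable (laplace g) μ :=
  (aestronglyMeasurable_prod_exp_smul hg μ).integral_prod_right'

theorem integrable_prod_exp_smul (hg : AEStronglyMeasurable g (volume.restrict (Ioi 0))) {t : ℝ}
    (ht : ∫⁻ s in Ioc 0 t, elaplace (fun r => ‖g r‖ₑ) s ≠ ∞) :
    Integrable (fun z : ℝ × ℝ => Real.exp (-(z.1 * z.2)) • g z.2)
      ((volume.restrict (Ioc 0 t)).prod (volume.restrict (Ioi 0))) := by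
  have hm := aestronglyMeasurable_prod_exp_smul hg (volume.restrict (Ioc 0 t))
  refine ⟨hm, ?_⟩
  rw [hasFiniteIntegral_iff_enorm, lintegral_prod _ hm.enorm]
  simpa only [lintegral_enorm_exp_smul] using ht.lt_top

theorem integrableOn_laplace (hg : AEStronglyMeasurable g (volume.restrict (Ioi 0))) {t : ℝ}
    (ht : ∫⁻ s in Ioc 0 t, elaplace (fun r => ‖g r‖ₑ) s ≠ ∞) : IntegrableOn (laplace g) (Ioc 0 t) :=
  (integrable_prod_exp_smul hg ht).integral_prod_left

variable [CompleteSpace E] [CompleteSpace F]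

theorem map_laplace (L : E →L[ℝ] F) {t : ℝ}
    (hg : IntegrableOn (fun r : ℝ => Real.exp (-(t * r)) • g r) (Ioi 0)) :
    L (laplace g t) = laplace (fun r => L (g r)) t := by
  simp only [laplace, ← L.integral_comp_comm hg, map_smul]

-- In `E` the function `h r / r` need not be integrable; only its image `-g r` in `F` is.
theorem map_setIntegral_laplace (L : E →L[ℝ] F) {h : ℝ → E} {g : ℝ → F}
    (hg : IntegrableOn g (Ioi 0)) (hh : AEStronglyMeasurable h (volume.restrict (Ioi 0)))
    (hLg : ∀ r, 0 < r → L (h r) = -(r • g r)) {t : ℝ} (ht : 0 ≤ t)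
    (hht : ∫⁻ s in Ioc 0 t, elaplace (fun r => ‖h r‖ₑ) s ≠ ∞) :
    L (∫ s in Ioc 0 t, laplace h s) = laplace g t - laplace g 0 := by
  have hprod := integrable_prod_exp_smul hh hht
  have hinner (r : ℝ) (hr : r ∈ Ioi 0) : ∫ s in Ioc 0 t, Real.exp (-(s * r)) • h r =
      (r⁻¹ * (1 - Real.exp (-(t * r)))) • h r := by
    rw [integral_smul_const, setIntegral_exp_neg_mul ht (ne_of_gt hr)]
  have hL (r : ℝ) (hr : r ∈ Ioi 0) : L ((r⁻¹ * (1 - Real.exp (-(t * r)))) • h r) =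
      Real.exp (-(t * r)) • g r - g r := by
    rw [map_smul, hLg r hr, mul_comm, mul_smul, smul_neg, inv_smul_smul₀ (ne_of_gt hr), smul_neg,
      sub_smul, one_smul, neg_sub]
  calc L (∫ s in Ioc 0 t, laplace h s)
      = L (∫ r in Ioi (0 : ℝ), (r⁻¹ * (1 - Real.exp (-(t * r)))) • h r) := by
        rw [← setIntegral_congr_fun measurableSet_Ioi hinner]
        exact congrArg L (integral_integral_swap hprod)
    _ = ∫ r in Ioi (0 : ℝ), (Real.exp (-(t * r)) • g r - g r) := by
        rw [← L.integral_comp_comm, setIntegral_congr_fun measurableSet_Ioi hL]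
        exact (integrableOn_congr_fun hinner measurableSet_Ioi).1 hprod.integral_prod_right
    _ = laplace g t - laplace g 0 := by
        rw [integral_sub (integrableOn_exp_smul hg ht) hg, laplace_zero, laplace]

end Laplace

theorem IsQuasiconcave.eLpNorm_laplace_le {E : Type*} [NormedAddCommGroup E] [NormedSpace ℝ E]
    {D : ℝ → ℝ≥0∞} (hD : IsQuasiconcave D) {g : ℝ → E}
    (hg : ∀ r, 0 < r → ‖g r‖ₑ ≤ D r * ENNReal.ofReal r⁻¹) {p : ℝ} (hp : 1 ≤ p) {θ : ℝ≥0∞}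
    (hθ : θ ≠ ∞) {w : ℝ → ℝ≥0} (hw : IsReverseDoubling θ w) :
    eLpNorm (laplace g) (ENNReal.ofReal p) (weightMeasure w) ≤
      laplaceConst p θ * interpFunctional (fun t => weightPrimitive w t ^ (1 / p)) p D :=
  (eLpNorm_mono_enorm fun t => (enorm_laplace_le g t).trans (elaplace_mono hg t)).trans
    (hD.eLpNorm_elaplace_le hp hθ hw)

theorem IsQuasiconcave.setLIntegral_elaplace_ne_top {D : ℝ → ℝ≥0∞} (hD : IsQuasiconcave D) {p : ℝ}
    (hp : 1 < p) {θ : ℝ≥0∞} (hθ : θ < 1) {w : ℝ → ℝ≥0} (hw : IsReverseDoubling θ w)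
    (hwm : AEMeasurable w (volume.restrict (Ioi 0))) (hwd : HasLocallyIntegrableDual p w)
    (hDw : interpFunctional (fun t => weightPrimitive w t ^ (1 / p)) p D ≠ ∞) {t : ℝ}
    (ht : 0 < t) : ∫⁻ s in Ioc 0 t, elaplace (fun r => D r * ENNReal.ofReal r⁻¹) s ≠ ∞ := by
  refine hwd.setLIntegral_ne_top hp hwm (antitone_elaplace _).measurable.aemeasurable ?_ ht
  exact ne_top_of_le_ne_top
    (ENNReal.mul_ne_top (laplaceConst_ne_top (zero_lt_one.trans hp) hθ) hDw)
    (hD.eLpNorm_elaplace_le hp.le hθ.ne_top hw)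

theorem IsQuasiconcave.lintegral_min_mul_ne_top {D : ℝ → ℝ≥0∞} (hD : IsQuasiconcave D)
    (h : ∫⁻ s in Ioc 0 1, elaplace (fun r => D r * ENNReal.ofReal r⁻¹) s ≠ ∞) :
    ∫⁻ r in Ioi (0 : ℝ), ENNReal.ofReal (min 1 r⁻¹) * (D r * ENNReal.ofReal r⁻¹) ≠ ∞ := by
  have hDm : Measurable D := hD.monotone.measurable
  intro hinf
  have hle := lintegral_min_mul_le_setLIntegral_elaplace
    (G := fun r => D r * ENNReal.ofReal r⁻¹) (by fun_prop)
  rw [hinf, ENNReal.mul_top (by simp [Real.exp_pos]), top_le_iff] at hle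
  exact h hle

namespace InterpolationCouple

variable {X₀ X₁ Z : Type*}
  [NormedAddCommGroup X₀] [NormedSpace ℝ X₀] [NormedAddCommGroup X₁] [NormedSpace ℝ X₁]
  [AddCommGroup Z] [Module ℝ Z] [TopologicalSpace Z] [IsTopologicalAddGroup Z]
  (C : InterpolationCouple X₀ X₁ Z)

theorem enorm_inv_smul_fst_le {D : ℝ → ℝ≥0∞} {v : ℝ → C.interSpace}
    (hvD : ∀ r, 0 < r → C.J r (v r) ≤ D r) (r : ℝ) (hr : 0 < r) :
    ‖r⁻¹ • (v r : X₀ × X₁).1‖ₑ ≤ D r * ENNReal.ofReal r⁻¹ := by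
  rw [enorm_smul, Real.enorm_of_nonneg (inv_nonneg.2 hr.le), mul_comm]
  exact mul_le_mul_left ((C.enorm_fst_le_J r _).trans (hvD r hr)) _

theorem enorm_neg_snd_le {D : ℝ → ℝ≥0∞} {v : ℝ → C.interSpace}
    (hvD : ∀ r, 0 < r → C.J r (v r) ≤ D r) (r : ℝ) (hr : 0 < r) :
    ‖-(v r : X₀ × X₁).2‖ₑ ≤ D r * ENNReal.ofReal r⁻¹ := by
  rw [enorm_neg, mul_comm]
  exact (C.enorm_snd_le_J hr _).trans (mul_le_mul_right (hvD r hr) _)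

/-- The `X₀`-valued function `t ↦ ∫₀^∞ e^{-tr} v(r) dr/r` on `(0,∞)`. -/
def extensionFst (v : ℝ → C.interSpace) : ℝ → X₀ := laplace fun r => r⁻¹ • (v r : X₀ × X₁).1

/-- The `X₁`-valued function `t ↦ -∫₀^∞ e^{-tr} v(r) dr`, the derivative of `extension`. -/
def extensionDeriv (v : ℝ → C.interSpace) : ℝ → X₁ := laplace fun r => -(v r : X₀ × X₁).2

section Topology

variable [T2Space Z]

/-- The function `t ↦ ∫₀^∞ e^{-tr} v(r) dr/r` with values in `X₀ + X₁`, which extends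
`∫₀^∞ v(r) dr/r` from `t = 0` to `t ≥ 0`. -/
def extension (v : ℝ → C.interSpace) : ℝ → C.SumSpace := laplace fun r => r⁻¹ • C.ofInter (v r)

namespace IsJRepresentation

variable {C} {v : ℝ → C.interSpace} {a : C.SumSpace} (hv : C.IsJRepresentation v a)

include hv

theorem extension_zero : C.extension v 0 = a := by
  rw [extension, laplace_zero, hv.integral_eq]

theorem aestronglyMeasurable_inv_smul_fst :
    AEStronglyMeasurable (fun r => r⁻¹ • (v r : X₀ × X₁).1) (volume.restrict (Ioi 0)) :=
  measurable_inv.aestronglyMeasurable.smul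
    ((continuous_fst.comp continuous_subtype_val).comp_aestronglyMeasurable hv.aestronglyMeasurable)

theorem aestronglyMeasurable_neg_snd :
    AEStronglyMeasurable (fun r => -(v r : X₀ × X₁).2) (volume.restrict (Ioi 0)) :=
  ((continuous_snd.comp continuous_subtype_val).comp_aestronglyMeasurable
    hv.aestronglyMeasurable).neg

theorem extension_eq_inl [CompleteSpace X₀] [CompleteSpace X₁] {t : ℝ}
    (ht : elaplace (fun r => ‖r⁻¹ • (v r : X₀ × X₁).1‖ₑ) t ≠ ∞) :
    C.extension v t = C.inl (C.extensionFst v t) := by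
  rw [← inlL_apply, extensionFst, map_laplace C.inlL
    (integrableOn_exp_smul_of_elaplace_ne_top hv.aestronglyMeasurable_inv_smul_fst ht)]
  simp only [extension, ofInter_eq_inl, map_smul, inlL_apply]

theorem extension_eq_add_inr [CompleteSpace X₀] [CompleteSpace X₁] {t : ℝ} (ht : 0 ≤ t)
    (hvt : ∫⁻ s in Ioc 0 t, elaplace (fun r => ‖-(v r : X₀ × X₁).2‖ₑ) s ≠ ∞) :
    C.extension v t = a + C.inr (∫ s in Ioc 0 t, C.extensionDeriv v s) := by
  rw [← inrL_apply, extensionDeriv, map_setIntegral_laplace C.inrL hv.integrableOn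
    hv.aestronglyMeasurable_neg_snd (fun r hr => ?_) ht hvt, ← extension, hv.extension_zero,
    add_sub_cancel]
  rw [smul_inv_smul₀ hr.ne', map_neg, inrL_apply, ofInter_eq_inr]

end IsJRepresentation

end Topology

end InterpolationCouple

/-- The constant of the extension theorem, in terms of the reverse doubling ratio `θ` of `W`. -/
def extensionConst (p : ℝ) (θ : ℝ≥0∞) : ℝ≥0∞ := 32 * laplaceConst p θ + 16

theorem extensionConst_ne_top {p : ℝ} (hp : 0 < p) {θ : ℝ≥0∞} (hθ : θ < 1) :
    extensionConst p θ ≠ ∞ :=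
  ENNReal.add_ne_top.2 ⟨ENNReal.mul_ne_top ENNReal.ofNat_ne_top (laplaceConst_ne_top hp hθ),
    ENNReal.ofNat_ne_top⟩

theorem theorem1p3_general {X₀ X₁ Z : Type*}
    [NormedAddCommGroup X₀] [NormedSpace ℝ X₀] [CompleteSpace X₀]
    [NormedAddCommGroup X₁] [NormedSpace ℝ X₁] [CompleteSpace X₁]
    [AddCommGroup Z] [Module ℝ Z] [TopologicalSpace Z] [IsTopologicalAddGroup Z] [T2Space Z]
    (C : InterpolationCouple X₀ X₁ Z) {p : ℝ} (hp : 1 < p) {θ : ℝ≥0∞} (hθ : θ < 1) {w : ℝ → ℝ≥0}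
    (hw : IsReverseDoubling θ w) (hwm : AEMeasurable w (volume.restrict (Ioi 0)))
    (hwd : HasLocallyIntegrableDual p w) {a : C.SumSpace}
    (ha : a ∈ C.interpSpace (fun t => weightPrimitive w t ^ (1 / p)) p) :
    ∃ (u : ℝ → C.SumSpace) (u₀ : ℝ → X₀) (f : ℝ → X₁) (v : ℝ → C.interSpace),
      (∀ t, 0 < t → u t = C.inl (u₀ t)) ∧
      MemLp u₀ (ENNReal.ofReal p) (weightMeasure w) ∧
      MemLp f (ENNReal.ofReal p) (weightMeasure w) ∧
      u 0 = a ∧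
      (∀ t, 0 < t → IntegrableOn f (Ioc 0 t) ∧ u t = a + C.inr (∫ s in Ioc 0 t, f s)) ∧
      eLpNorm u₀ (ENNReal.ofReal p) (weightMeasure w) +
          eLpNorm f (ENNReal.ofReal p) (weightMeasure w) ≤
        extensionConst p θ * C.interpNorm (fun t => weightPrimitive w t ^ (1 / p)) p a ∧
      C.IsJRepresentation v a ∧
      interpFunctional (fun t => weightPrimitive w t ^ (1 / p)) p (fun r => C.J r (v r)) ≤
        extensionConst p θ * C.interpNorm (fun t => weightPrimitive w t ^ (1 / p)) p a ∧
      (∀ t, 0 ≤ t →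
        IntegrableOn (fun r : ℝ => (Real.exp (-(t * r)) * r⁻¹) • C.ofInter (v r)) (Ioi 0) ∧
        u t = ∫ r in Ioi (0 : ℝ), (Real.exp (-(t * r)) * r⁻¹) • C.ofInter (v r)) := by
  have hp0 : 0 < p := zero_lt_one.trans hp
  set A := C.interpNorm (fun t => weightPrimitive w t ^ (1 / p)) p a
  have hK := C.isQuasiconcave_K a
  have hD := hK.const_mul 16
  have hDA : interpFunctional (fun t => weightPrimitive w t ^ (1 / p)) p (fun r => 16 * C.K r a) =
      16 * A := interpFunctional_const_mul hp0 _ ENNReal.ofNat_ne_top _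
  have hDfin {t : ℝ} (ht : 0 < t) := hD.setLIntegral_elaplace_ne_top hp hθ hw hwm hwd
    (hDA ▸ ENNReal.mul_ne_top ENNReal.ofNat_ne_top (ne_of_lt ha)) ht
  obtain ⟨v, hv, hvD⟩ := C.exists_isJRepresentation a
    (hK.lintegral_min_mul_ne_top
      (hK.setLIntegral_elaplace_ne_top hp hθ hw hwm hwd (ne_of_lt ha) one_pos))
  have hfst := C.enorm_inv_smul_fst_le hvD
  have hsnd := C.enorm_neg_snd_le hvD
  have hu₀ := hDA ▸ hD.eLpNorm_laplace_le hfst hp.le hθ.ne_top hw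
  have hf := hDA ▸ hD.eLpNorm_laplace_le hsnd hp.le hθ.ne_top hw
  have hBfin : laplaceConst p θ * (16 * A) < ∞ :=
    ENNReal.mul_lt_top (laplaceConst_ne_top hp0 hθ).lt_top
      (ENNReal.mul_lt_top ENNReal.ofNat_lt_top ha)
  have hsndfin {t : ℝ} (ht : 0 < t) := ne_top_of_le_ne_top (hDfin ht)
    (lintegral_mono fun s => elaplace_mono hsnd s)
  refine ⟨C.extension v, C.extensionFst v, C.extensionDeriv v, v,
    fun t ht => hv.extension_eq_inl
      (ne_top_of_le_ne_top (elaplace_ne_top ht (hDfin ht)) (elaplace_mono hfst t)),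
    ⟨aestronglyMeasurable_laplace hv.aestronglyMeasurable_inv_smul_fst _, hu₀.trans_lt hBfin⟩,
    ⟨aestronglyMeasurable_laplace hv.aestronglyMeasurable_neg_snd _, hf.trans_lt hBfin⟩,
    hv.extension_zero,
    fun t ht => ⟨integrableOn_laplace hv.aestronglyMeasurable_neg_snd (hsndfin ht),
      hv.extension_eq_add_inr ht.le (hsndfin ht)⟩,
    ?_, hv, ?_, fun t ht => ?_⟩
  · calc eLpNorm (C.extensionFst v) (ENNReal.ofReal p) (weightMeasure w) +
          eLpNorm (C.extensionDeriv v) (ENNReal.ofReal p) (weightMeasure w)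
        ≤ laplaceConst p θ * (16 * A) + laplaceConst p θ * (16 * A) := add_le_add hu₀ hf
      _ = 32 * laplaceConst p θ * A := by ring
      _ ≤ extensionConst p θ * A := mul_le_mul_left le_self_add _
  · exact (interpFunctional_mono hp0.le _ hvD).trans
      (hDA.trans_le (mul_le_mul_left le_add_self _))
  · simp only [mul_smul]
    exact ⟨integrableOn_exp_smul hv.integrableOn ht, rfl⟩

end

theorem theorem1p3 (p : ℝ) (hp : 1 < p) :
    ∃ N : ℝ≥0∞ → ℝ≥0,
      ∀ (X₀ X₁ Z : Type*)
        [NormedAddCommGroup X₀] [NormedSpace ℝ X₀] [CompleteSpace X₀]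
        [NormedAddCommGroup X₁] [NormedSpace ℝ X₁] [CompleteSpace X₁]
        [AddCommGroup Z] [Module ℝ Z] [TopologicalSpace Z] [IsTopologicalAddGroup Z]
        [ContinuousSMul ℝ Z] [T2Space Z]
        (C : InterpolationCouple X₀ X₁ Z)
        (w : ℝ → ℝ≥0) (_ : IsMuckenhoupt p w)
        (a : C.SumSpace)
        (_ : a ∈ C.interpSpace (fun t => weightPrimitive w t ^ (1 / p)) p),
        -- `u : [0,∞) → X₀ + X₁`, which on `(0,∞)` is the `X₀`-valued function `u₀`
        ∃ (u : ℝ → C.SumSpace) (u₀ : ℝ → X₀) (f : ℝ → X₁) (v : ℝ → C.interSpace),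
          (∀ t, 0 < t → u t = C.inl (u₀ t)) ∧
          MemLp u₀ (ENNReal.ofReal p) (weightMeasure w) ∧
          MemLp f (ENNReal.ofReal p) (weightMeasure w) ∧
          u 0 = a ∧
          (∀ t, 0 < t → IntegrableOn f (Ioc 0 t) ∧
            u t = a + C.inr (∫ s in Ioc 0 t, f s)) ∧
          eLpNorm u₀ (ENNReal.ofReal p) (weightMeasure w) +
              eLpNorm f (ENNReal.ofReal p) (weightMeasure w) ≤
            N (muckenhouptConst p w) *
              C.interpNorm (fun t => weightPrimitive w t ^ (1 / p)) p a ∧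
          -- the form of `u`
          C.IsJRepresentation v a ∧
          interpFunctional (fun t => weightPrimitive w t ^ (1 / p)) p (fun r => C.J r (v r)) ≤
            N (muckenhouptConst p w) *
              C.interpNorm (fun t => weightPrimitive w t ^ (1 / p)) p a ∧
          (∀ t, 0 ≤ t →
            IntegrableOn (fun r : ℝ => (Real.exp (-(t * r)) * r⁻¹) • C.ofInter (v r)) (Ioi 0) ∧
            u t = ∫ r in Ioi (0 : ℝ), (Real.exp (-(t * r)) * r⁻¹) • C.ofInter (v r)) := by
  refine ⟨fun q => (extensionConst p (reverseDoublingRatio p q)).toNNReal, ?_⟩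
  intro X₀ X₁ Z _ _ _ _ _ _ _ _ _ _ _ _ C w hw a ha
  have hθ := reverseDoublingRatio_lt_one (zero_lt_one.trans hp).le hw.const_lt_top.ne
  rw [ENNReal.coe_toNNReal (extensionConst_ne_top (zero_lt_one.trans hp) hθ)]
  exact theorem1p3_general C hp hθ (hw.isReverseDoubling hp) hw.aemeasurable.restrict
    (hw.hasLocallyIntegrableDual hp) ha
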